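/- **Setting.** For $x\in\mathbb R$ and $q\in\mathbb N$ let $[x]_q=\lfloor qx\rfloor/q$, and let $H$ denote Shannon entropy in bits. For a real random variable $U$ and a random vector $Y$ put $$d(U)=\lim_{q\to\infty}\frac{H([U]_q)}{\log_2 q},\qquad d(U\mid Y)=\lim_{q\to\infty}\frac{H([U]_q\mid Y)}{\log_2 q}$$ whenever the limits exist (Rényi information dimension, RID, and conditional RID), where $H([U]_q\mid Y)$ is the average over $y$, under the law of $Y$, of the entropy of the conditional law of $[U]_q$ given $Y=y$. For $N=2^n$ let $H_N$ be the Hadamard matrix given by $H_1=(1)$, $H_{2N}=\begin{pmatrix}H_N&H_N\\H_N&-H_N\end{pmatrix}$. The erasure process with initial value $\alpha\in[0,1]$ assigns to every finite sign sequence the number defined by $e^{\emptyset}=\alpha$, $e^{b_1\dots b_n+}=2e^{b_1\dots b_n}-(e^{b_1\dots b_n})^2$, $e^{b_1\dots b_n-}=(e^{b_1\dots b_n})^2$. **Theorem.** Let $X_1,X_2,\dots$ be i.i.d. real random variables with finite second moment whose law is nonsingular, $p_X=(1-\delta)p_d+\delta p_c$ with $\delta\in[0,1]$, $p_d$ a discrete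 and $p_c$ an absolutely continuous probability measure. For $n\ge 0$ and $N=2^n$ let $Z_1^N=H_NX_1^N$. Then: 1. $d(X)=d(X_1)$ exists and equals $\delta$, and $I_n(i)=d(Z_i\mid Z_1,\dots,Z_{i-1})$ exists for all $n\ge 0$ and $1\le i\le 2^n$. 2. For all $n$ and $i$, let $b_1b_2\dots b_n$ be the $n$-digit binary expansion of $i-1$, most significant digit first, with the digit $0$ read as $+$ and the digit $1$ as $-$, and write $I^{b_1\dots b_n}=I_n(i)$. Then $I^{b_1\dots b_n}=e^{b_1\dots b_n}$, where $e$ is the erasure process with initial value $d(X)$. 3. Let $B_1,B_2,\dots$ be i.i.d. uniform $\{+,-\}$-valued random variables and $\mathcal F_n=\sigma(B_1,\dots,B_n)$. Then $I_n=I^{B_1\dots B_n}$ is a martingale with respect to $(\mathcal F_n)$, and it converges almost surely to a random variable $I_\infty$ with $I_\infty\in\{0,1\}$ almost surely and $\mathbb P(I_\infty=1)=d(X)$. 4. For every $\varepsilon\in(0,1)$, as $n\to\infty$, $$\frac{\#\{i\le 2^n: I_n(i)>1-\varepsilon\}}{2^n}\to d(X),\qquad \frac{\#\{i\le 2^n: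 I_n(i)<\varepsilon\}}{2^n}\to 1-d(X).$$ -/

import Mathlib

open MeasureTheory ProbabilityTheory Filter Topology
open scoped ENNReal NNReal

noncomputable section

/-! ### Nonsingular laws -/

/-- A law `ν` on `ℝ` is a nonsingular (discrete-continuous) mixture whose continuous part has
weight `δ`: `ν = (1 - δ) p_d + δ p_c` with `p_d` a discrete probability measure and `p_c` a
probability measure that has a density. -/
def IsNonsingularMixture (ν : Measure ℝ) (δ : ℝ) : Prop :=
  δ ∈ Set.Icc (0 : ℝ) 1 ∧
  ∃ pd pc : Measure ℝ, IsProbabilityMeasure pd ∧ IsProbabilityMeasure pc ∧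
    (∃ S : Set ℝ, S.Countable ∧ pd Sᶜ = 0) ∧ pc ≪ volume ∧
    ν = ENNReal.ofReal (1 - δ) • pd + ENNReal.ofReal δ • pc

/-! ### Entropy of quantized random variables and Rényi information dimension -/

/-- The uniform quantization `[x]_q = ⌊q x⌋ / q`. -/
def quantize (q : ℕ) (x : ℝ) : ℝ := (⌊(q : ℝ) * x⌋ : ℝ) / q

/-- The Shannon entropy, in bits, of a discrete probability law on `ℝ`:
`∑ₓ -ν{x} log₂ ν{x}`, a value in `[0, ∞]`. -/
def entropyOfLaw (ν : Measure ℝ) : ℝ≥0∞ :=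
  ∑' x : ℝ, ENNReal.ofReal (-(ν.real {x} * Real.logb 2 (ν.real {x})))

/-- `H(D)` for a discrete real random variable `D`. -/
def discreteEntropy {Ω : Type*} [MeasurableSpace Ω] (P : Measure Ω) (D : Ω → ℝ) : ℝ≥0∞ :=
  entropyOfLaw (P.map D)

/-- `H(D | Y)` for a discrete real random variable `D` and an arbitrary random element `Y`:
the average over `y`, under the law of `Y`, of the entropy of the regular conditional law of `D`
given `Y = y`. -/
def discreteCondEntropy {Ω β : Type*} [MeasurableSpace Ω] [MeasurableSpace β]
    (P : Measure Ω) [IsFiniteMeasure P] (D : Ω → ℝ) (Y : Ω → β) : ℝ≥0∞ :=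
  ∫⁻ y, entropyOfLaw (condDistrib D Y P y) ∂(P.map Y)

/-- `H([U]_q) / log₂ q`. -/
def ridRatio {Ω : Type*} [MeasurableSpace Ω] (P : Measure Ω) (U : Ω → ℝ) (q : ℕ) : ℝ≥0∞ :=
  discreteEntropy P (fun ω => quantize q (U ω)) / ENNReal.ofReal (Real.logb 2 q)

/-- `H([U]_q | Y) / log₂ q`. -/
def condRIDRatio {Ω β : Type*} [MeasurableSpace Ω] [MeasurableSpace β]
    (P : Measure Ω) [IsFiniteMeasure P] (U : Ω → ℝ) (Y : Ω → β) (q : ℕ) : ℝ≥0∞ :=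
  discreteCondEntropy P (fun ω => quantize q (U ω)) Y / ENNReal.ofReal (Real.logb 2 q)

/-- The RID of `U` exists: `H([U]_q) / log₂ q` has a finite limit as `q → ∞`. -/
def RIDExists {Ω : Type*} [MeasurableSpace Ω] (P : Measure Ω) (U : Ω → ℝ) : Prop :=
  ∃ d : ℝ≥0, Tendsto (ridRatio P U) atTop (𝓝 (d : ℝ≥0∞))

/-- The conditional RID of `U` given `Y` exists: `H([U]_q | Y) / log₂ q` has a finite limit as
`q → ∞`. -/
def CondRIDExists {Ω β : Type*} [MeasurableSpace Ω] [MeasurableSpace β]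
    (P : Measure Ω) [IsFiniteMeasure P] (U : Ω → ℝ) (Y : Ω → β) : Prop :=
  ∃ d : ℝ≥0, Tendsto (condRIDRatio P U Y) atTop (𝓝 (d : ℝ≥0∞))

/-- The RID `d(U) = lim_q H([U]_q) / log₂ q` (meaningful when `RIDExists P U`). -/
def rid {Ω : Type*} [MeasurableSpace Ω] (P : Measure Ω) (U : Ω → ℝ) : ℝ :=
  (limUnder atTop (ridRatio P U)).toReal

/-- The conditional RID `d(U | Y) = lim_q H([U]_q | Y) / log₂ q` (meaningful when
`CondRIDExists P U Y`). -/
def condRID {Ω β : Type*} [MeasurableSpace Ω] [MeasurableSpace β]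
    (P : Measure Ω) [IsFiniteMeasure P] (U : Ω → ℝ) (Y : Ω → β) : ℝ :=
  (limUnder atTop (condRIDRatio P U Y)).toReal

/-! ### The Hadamard transform -/

/-- Entries of the Hadamard matrices, by the block recursion `H_1 = [1]`,
`H_{2N} = [[H_N, H_N], [H_N, -H_N]]` with `N = 2 ^ n` (rows and columns numbered from `0`). -/
def hadamardEntry : ℕ → ℕ → ℕ → ℝ
  | 0, _, _ => 1
  | n + 1, i, j =>
    (if 2 ^ n ≤ i ∧ 2 ^ n ≤ j then -1 else 1) * hadamardEntry n (i % 2 ^ n) (j % 2 ^ n)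

/-- The Hadamard matrix of order `2 ^ n`. -/
def hadamardMatrix (n : ℕ) : Matrix (Fin (2 ^ n)) (Fin (2 ^ n)) ℝ :=
  Matrix.of fun i j => hadamardEntry n i j

/-- The transformed sequence `Z = H_N (X_0, …, X_{N-1})`, `N = 2 ^ n`. -/
def hadamardTransform {Ω : Type*} (X : ℕ → Ω → ℝ) (n : ℕ) (i : Fin (2 ^ n)) (ω : Ω) : ℝ :=
  (hadamardMatrix n).mulVec (fun j => X j ω) i

/-- The components `Z_j`, `j < i`, preceding `Z_i`, as a random vector. -/
def hadamardPast {Ω : Type*} (X : ℕ → Ω → ℝ) (n : ℕ) (i : Fin (2 ^ n)) (ω : Ω) :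
    Set.Iio i → ℝ :=
  fun j => hadamardTransform X n j ω

/-- `I_n(i) = d(Z_i | Z_j, j < i)`. -/
def hadamardRID {Ω : Type*} [MeasurableSpace Ω] (P : Measure Ω) [IsFiniteMeasure P]
    (X : ℕ → Ω → ℝ) (n : ℕ) (i : Fin (2 ^ n)) : ℝ :=
  condRID P (hadamardTransform X n i) (hadamardPast X n i)

/-! ### Binary labels and the erasure process

A sign sequence `b₁, b₂, …` is a function `b : ℕ → Bool` with `b k` standing for `b_{k+1}`;
`false` is the binary digit `0`, that is `+`, and `true` is the binary digit `1`, that is `-`. -/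

/-- The index (from `0` to `2 ^ n - 1`) whose binary expansion, most significant digit first, is
`b₁ b₂ … bₙ`. -/
def pathIndex (b : ℕ → Bool) : (n : ℕ) → Fin (2 ^ n)
  | 0 => 0
  | n + 1 => ⟨2 * (pathIndex b n : ℕ) + (b n).toNat, by
      have h := (pathIndex b n).isLt
      have h' := Bool.toNat_le (b n)
      rw [pow_succ]
      omega⟩

/-- The erasure process `e^{b₁ … bₙ}` with initial value `α`: `e ↦ 2 e - e²` along `+` and
`e ↦ e²` along `-`. -/
def erasureProcess (α : ℝ) (b : ℕ → Bool) : ℕ → ℝ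
  | 0 => α
  | n + 1 =>
    if b n then (erasureProcess α b n) ^ 2
    else 2 * erasureProcess α b n - (erasureProcess α b n) ^ 2

/-- The filtration `ℱ_n = σ(B₁, …, Bₙ)`, where `B k` stands for `B_{k+1}`. -/
def labelFiltration {Ω' : Type*} [m : MeasurableSpace Ω'] (B : ℕ → Ω' → Bool)
    (hB : ∀ k, Measurable (B k)) : Filtration ℕ m where
  seq n := ⨆ k : Fin n, MeasurableSpace.comap (B k) inferInstance
  mono' := fun _ _ hmn => iSup_le fun k =>
    le_iSup_of_le (Fin.castLE hmn k) le_rfl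
  le' := fun _ => iSup_le fun k => (hB k).comap_le

end

/-! The law of `X` splits along a countable set `S`: on `X ∈ S` it is discrete, and off `S`, an
event of probability `δ`, it has a density. Fix which coordinates are continuous. If some vector `w`
supported on them is killed by the past forms `L k` but not by the new form `K`, then moving along
`w` keeps the past fixed and spreads `K` with a density, so quantizing `K` reveals about `log₂ q`
bits. Otherwise, once the discrete values are known, `K` is an affine function of the past; finitely
many discrete values carry all but `ε` of the probability, so the cost is at most `ε log₂ q + O(1)`.
Hence the conditional dimension is the probability that `K` innovates
(`tendsto_condRIDRatio_linear`, built on `exists_le_discreteCondEntropy_quantize` and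
`exists_discreteCondEntropy_quantize_le`).

For the Hadamard matrix, rows `2i` and `2i+1` of the next order are the sum and the difference of
row `i` applied to the even and to the odd inputs. The sum innovates when one half does, and the
difference, given the sum, when both do (`hadamardInnovates_plus`, `hadamardInnovates_minus`). The
halves use disjoint independent inputs, so the probability `p` becomes `2p - p²` or `p²`: this is
the erasure process (`measureReal_hadamardInnovates`).

With fair signs each step adds `±(e - e²)`. The process is a bounded martingale, so it converges;
its increments die out, which forces the limit into `{0, 1}`, and the mean `δ` is preserved
(`exists_limit_erasureProcess`). A random path is uniform on the indices, which turns probabilities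
into fractions (`measureReal_pathIndex_mem`). -/

/-! ### Quantization grid and Gibbs' inequality. -/

lemma measurable_quantize (q : ℕ) : Measurable (quantize q) := by
  unfold quantize
  fun_prop

lemma quantize_mem_range (q : ℕ) (x : ℝ) :
    quantize q x ∈ Set.range (fun k : ℤ => (k : ℝ) / q) := ⟨⌊(q : ℝ) * x⌋, rfl⟩

lemma grid_injective {q : ℕ} (hq : 0 < q) : Function.Injective (fun k : ℤ => (k : ℝ) / q) := by
  intro a b h
  have hq' : (q : ℝ) ≠ 0 := by positivity
  simpa [div_left_inj' hq'] using h

/-- Each quantization cell has length `1/q`, so sums over the grid become Lebesgue integrals. The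
integrand factors through `ℤ`, hence `f` may be arbitrary. -/
lemma lintegral_comp_quantize {q : ℕ} (hq : 0 < q) (f : ℝ → ℝ≥0∞) :
    ∫⁻ u, f (quantize q u) = (q : ℝ≥0∞)⁻¹ * ∑' k : ℤ, f ((k : ℝ) / q) := by
  have hq' : (0 : ℝ) < q := by exact_mod_cast hq
  have hm : Measurable (fun u : ℝ => ⌊(q : ℝ) * u⌋) := by fun_prop
  have h1 : ∫⁻ u, f (quantize q u) =
      ∫⁻ k : ℤ, f ((k : ℝ) / q) ∂(volume.map (fun u : ℝ => ⌊(q : ℝ) * u⌋)) := by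
    rw [lintegral_map measurable_from_top hm]
    rfl
  rw [h1, lintegral_countable', ← ENNReal.tsum_mul_left]
  refine tsum_congr fun k => ?_
  rw [Measure.map_apply hm (measurableSet_singleton k)]
  have : (fun u : ℝ => ⌊(q : ℝ) * u⌋) ⁻¹' {k} = Set.Ico ((k : ℝ) / q) (((k : ℝ) + 1) / q) := by
    ext u
    simp only [Set.mem_preimage, Set.mem_singleton_iff, Int.floor_eq_iff, Set.mem_Ico,
      div_le_iff₀ hq', lt_div_iff₀ hq', mul_comm u]
  rw [this, Real.volume_Ico, mul_comm]
  congr 1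
  rw [show ((k : ℝ) + 1) / q - k / q = (q : ℝ)⁻¹ by field_simp; ring,
    ENNReal.ofReal_inv_of_pos hq', ENNReal.ofReal_natCast]

lemma entropyOfLaw_eq_lintegral (ν : Measure ℝ) [IsProbabilityMeasure ν] {Q : Set ℝ}
    (hQ : Q.Countable) (hν : ν Qᶜ = 0) :
    entropyOfLaw ν = ∫⁻ x, ENNReal.ofReal (-Real.logb 2 (ν.real {x})) ∂ν := by
  have hres : ν.restrict Q = ν := Measure.restrict_eq_self_of_ae_mem (ae_iff.2 hν)
  rw [← hres, lintegral_countable _ hQ, hres]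
  unfold entropyOfLaw
  rw [← tsum_subtype_eq_of_support_subset (s := Q)]
  · refine tsum_congr fun x => ?_
    rw [← mul_neg, ENNReal.ofReal_mul measureReal_nonneg, mul_comm]
    simp [Measure.real]
  · intro x hx
    by_contra hxQ
    have : ν {x} = 0 := measure_mono_null (by simpa using hxQ) hν
    simp [Measure.real, this] at hx

/-- This is `log t ≤ t - 1` at `t = g / p`. Keeping the term `g / log 2` allows weights `g` that are
not normalized. -/
lemma neg_mul_logb_le {p g : ℝ} (hp : 0 ≤ p) (hg : 0 < g) :
    -(p * Real.logb 2 p) ≤ p * Real.logb 2 g⁻¹ + g / Real.log 2 := by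
  have h2 : 0 < Real.log 2 := Real.log_pos one_lt_two
  rcases hp.eq_or_lt with rfl | hp
  · simp; positivity
  have h := Real.log_le_sub_one_of_pos (div_pos hg hp)
  rw [Real.log_div hg.ne' hp.ne'] at h
  have h3 : p * (Real.log g - Real.log p) ≤ g := by
    have := mul_le_mul_of_nonneg_left h hp.le
    have e : p * (g / p - 1) = g - p := by field_simp
    linarith
  unfold Real.logb
  rw [Real.log_inv, ← sub_nonneg]
  have : p * (-Real.log g / Real.log 2) + g / Real.log 2 - -(p * (Real.log p / Real.log 2))
    = (g - p * (Real.log g - Real.log p)) / Real.log 2 := by field_simp; ring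
  rw [this]
  exact div_nonneg (by linarith) h2.le

/-- Gibbs' inequality for a law carried by a countable set, with an arbitrary positive weight. -/
lemma entropyOfLaw_le_gibbs (ν : Measure ℝ) [IsProbabilityMeasure ν] {Q : Set ℝ}
    (hQ : Q.Countable) (hν : ν Qᶜ = 0) (g : ℝ → ℝ) (hg : ∀ x, 0 < g x) (hg1 : ∀ x, g x ≤ 1) :
    entropyOfLaw ν ≤ ∫⁻ x, ENNReal.ofReal (Real.logb 2 (g x)⁻¹) ∂ν +
      ENNReal.ofReal (Real.log 2)⁻¹ * ∑' x : Q, ENNReal.ofReal (g x) := by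
  have hres : ν.restrict Q = ν := Measure.restrict_eq_self_of_ae_mem (ae_iff.2 hν)
  rw [← hres, lintegral_countable _ hQ, hres, ← ENNReal.tsum_mul_left, ← ENNReal.tsum_add]
  unfold entropyOfLaw
  rw [← tsum_subtype_eq_of_support_subset (s := Q)]
  · refine ENNReal.tsum_le_tsum fun x => ?_
    have h2 : 0 < Real.log 2 := Real.log_pos one_lt_two
    have h0 : 0 ≤ Real.logb 2 (g x)⁻¹ :=
      Real.logb_nonneg one_lt_two ((one_le_inv₀ (hg x)).2 (hg1 x))
    refine (ENNReal.ofReal_le_ofReal (neg_mul_logb_le measureReal_nonneg (hg x))).trans ?_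
    rw [ENNReal.ofReal_add (mul_nonneg measureReal_nonneg h0) (by have := hg x; positivity),
      mul_comm, ENNReal.ofReal_mul h0, div_eq_inv_mul, ENNReal.ofReal_mul (by positivity)]
    simp [Measure.real]
  · intro x hx
    by_contra hxQ
    have : ν {x} = 0 := measure_mono_null (by simpa using hxQ) hν
    simp [Measure.real, this] at hx

/-! ### Conditional entropy as the mean of minus the log of a conditional atom. -/

section CondEntropy

variable {Ω β : Type*} [MeasurableSpace Ω] [MeasurableSpace β] {P : Measure Ω}
  [IsProbabilityMeasure P] {D : Ω → ℝ} {Y : Ω → β}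

lemma condDistrib_compl_eq_zero (hD : Measurable D) (hY : Measurable Y) {Q : Set ℝ}
    (hQ : MeasurableSet Q) (hDQ : ∀ ω, D ω ∈ Q) :
    ∀ᵐ y ∂P.map Y, condDistrib D Y P y Qᶜ = 0 := by
  have h := congrArg (fun μ => μ Qᶜ) (condDistrib_comp_map (μ := P) hY.aemeasurable hD.aemeasurable)
  rw [Measure.bind_apply hQ.compl (Kernel.aemeasurable _), Measure.map_apply hD hQ.compl] at h
  have h0 : D ⁻¹' Qᶜ = ∅ := by
    ext ω; simpa using hDQ ω
  rw [h0, measure_empty, lintegral_eq_zero_iff (Kernel.measurable_coe _ hQ.compl)] at h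
  exact h

lemma lintegral_lintegral_condDistrib (hD : Measurable D) (hY : Measurable Y)
    {F : β × ℝ → ℝ≥0∞} (hF : Measurable F) :
    ∫⁻ y, ∫⁻ x, F (y, x) ∂(condDistrib D Y P y) ∂(P.map Y) = ∫⁻ ω, F (Y ω, D ω) ∂P := by
  rw [← Measure.lintegral_compProd hF, compProd_map_condDistrib hD.aemeasurable,
    lintegral_map hF (hY.prodMk hD)]

lemma measurable_kernel_singleton (κ : Kernel β ℝ) [IsSFiniteKernel κ] {γ : Type*}
    [MeasurableSpace γ] {f : γ → β} {g : γ → ℝ} (hf : Measurable f) (hg : Measurable g) :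
    Measurable (fun z => κ (f z) {g z}) := by
  have h : MeasurableSet {z : γ × ℝ | z.2 = g z.1} :=
    measurableSet_eq_fun measurable_snd (hg.comp measurable_fst)
  exact Kernel.measurable_kernel_prodMk_left (κ := κ.comap f hf) h

lemma discreteCondEntropy_eq_lintegral (hD : Measurable D) (hY : Measurable Y) {Q : Set ℝ}
    (hQ : Q.Countable) (hDQ : ∀ ω, D ω ∈ Q) :
    discreteCondEntropy P D Y =
      ∫⁻ ω, ENNReal.ofReal (-Real.logb 2 ((condDistrib D Y P (Y ω)).real {D ω})) ∂P := by
  have hm : Measurable (fun z : β × ℝ =>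
      ENNReal.ofReal (-Real.logb 2 ((condDistrib D Y P z.1).real {z.2}))) := by
    have := (measurable_kernel_singleton (condDistrib D Y P) measurable_fst
      measurable_snd).ennreal_toReal
    exact ((Real.measurable_log.comp this).div_const _).neg.ennreal_ofReal
  rw [← lintegral_lintegral_condDistrib hD hY hm]
  refine lintegral_congr_ae ?_
  filter_upwards [condDistrib_compl_eq_zero hD hY hQ.measurableSet hDQ] with y hy
  exact entropyOfLaw_eq_lintegral _ hQ hy

/-- Markov's inequality for the information `-log₂ p(D | Y)`: it is at least `log₂ (1/l)` wherever
the conditional atom is at most `l`. -/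
lemma mul_measure_le_discreteCondEntropy (hD : Measurable D) (hY : Measurable Y) {Q : Set ℝ}
    (hQ : Q.Countable) (hDQ : ∀ ω, D ω ∈ Q) {l : ℝ} :
    ENNReal.ofReal (Real.logb 2 l⁻¹) *
      P {ω | condDistrib D Y P (Y ω) {D ω} ≤ ENNReal.ofReal l} ≤ discreteCondEntropy P D Y := by
  have hm := measurable_kernel_singleton (condDistrib D Y P) hY hD
  -- Since `Real.logb 2 0 = 0`, the pointwise bound would fail at null atoms; almost surely the
  -- realized value is not one.
  have hpos : ∀ᵐ ω ∂P, condDistrib D Y P (Y ω) {D ω} ≠ 0 := by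
    have hm' : Measurable (fun z : β × ℝ => Set.indicator {z : β × ℝ |
        condDistrib D Y P z.1 {z.2} = 0} (1 : β × ℝ → ℝ≥0∞) z) :=
      measurable_one.indicator (measurable_kernel_singleton (condDistrib D Y P) measurable_fst
        measurable_snd (measurableSet_singleton 0))
    have h := lintegral_lintegral_condDistrib (P := P) hD hY hm'
    have h0 : ∫⁻ y, ∫⁻ x, Set.indicator {z : β × ℝ |
        condDistrib D Y P z.1 {z.2} = 0} (1 : β × ℝ → ℝ≥0∞) (y, x)
        ∂(condDistrib D Y P y) ∂(P.map Y) = 0 := by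
      refine (lintegral_congr_ae ?_).trans lintegral_zero
      filter_upwards [condDistrib_compl_eq_zero hD hY hQ.measurableSet hDQ] with y hy
      have hres : (condDistrib D Y P y).restrict Q = condDistrib D Y P y :=
        Measure.restrict_eq_self_of_ae_mem (ae_iff.2 hy)
      rw [← hres, lintegral_countable _ hQ]
      simp only [ENNReal.tsum_eq_zero, mul_eq_zero]
      intro x
      by_cases hx : condDistrib D Y P y {(x : ℝ)} = 0
      · exact Or.inr hx
      · exact Or.inl (Set.indicator_of_notMem
          (s := {z : β × ℝ | condDistrib D Y P z.1 {z.2} = 0}) hx _)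
    replace h := (lintegral_eq_zero_iff (hm'.comp (hY.prodMk hD))).1 (h.symm.trans h0)
    filter_upwards [h] with ω hω h1
    simp [h1] at hω
  rw [discreteCondEntropy_eq_lintegral hD hY hQ hDQ]
  set s := {ω | condDistrib D Y P (Y ω) {D ω} ≤ ENNReal.ofReal l}
  have hs : MeasurableSet s := measurableSet_le hm measurable_const
  rw [← lintegral_indicator_const hs]
  refine lintegral_mono_ae ?_
  filter_upwards [hpos] with ω h0
  by_cases hω : ω ∈ s
  swap
  · rw [Set.indicator_of_notMem hω]
    exact zero_le
  rw [Set.indicator_of_mem hω]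
  refine ENNReal.ofReal_le_ofReal ?_
  have hp : 0 < (condDistrib D Y P (Y ω)).real {D ω} :=
    ENNReal.toReal_pos h0 (measure_ne_top _ _)
  have hl : 0 < l := by
    by_contra h
    rw [Set.mem_ofPred_eq, ENNReal.ofReal_of_nonpos (not_lt.1 h)] at hω
    exact h0 (le_antisymm hω zero_le)
  rw [Real.logb_inv, neg_le_neg_iff]
  exact Real.logb_le_logb_of_le one_lt_two hp (ENNReal.toReal_le_of_le_ofReal hl.le hω)

end CondEntropy

/-! ### Growth of the entropy of a quantized variable, from below and from above. -/

lemma exists_pos_measure_lt_of_absolutelyContinuous {α : Type*} [MeasurableSpace α]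
    {μ m : Measure α} [IsFiniteMeasure μ] [SigmaFinite m] (h : μ ≪ m) {ε : ℝ≥0∞} (hε : ε ≠ 0) :
    ∃ d > 0, ∀ s, MeasurableSet s → m s < d → μ s < ε := by
  have hf : ∫⁻ x, μ.rnDeriv m x ∂m ≠ ∞ := (Measure.lintegral_rnDeriv_lt_top μ m).ne
  obtain ⟨d, hd, H⟩ := exists_pos_setLIntegral_lt_of_measure_lt hf hε
  refine ⟨d, hd, fun s hs hsd => ?_⟩
  have := H s hsd
  rwa [← withDensity_apply _ hs, Measure.withDensity_rnDeriv_eq _ _ h] at this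

section Quantize

variable {Ω β : Type*} [MeasurableSpace Ω] [MeasurableSpace β] {P : Measure Ω}
  [IsProbabilityMeasure P] {U : Ω → ℝ} {Y : Ω → β}

lemma tsum_grid_le_measure_univ (ν : Measure ℝ) {q : ℕ} (hq : 0 < q) :
    ∑' k : ℤ, ν {(k : ℝ) / q} ≤ ν Set.univ := by
  rw [← measure_iUnion (fun a b hab => by
    simpa using (grid_injective hq).ne hab) (fun _ => measurableSet_singleton _)]
  exact measure_mono (Set.subset_univ _)

/-- For fixed `y` the grid atoms sum to at most `1`, so `u ↦ κ y {quantize q u}` has integral at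
most `1/q`. Markov's inequality at level `L/q` then gives a bound free of `q`. -/
lemma prod_measure_large_atom_le (κ : Kernel β ℝ) [IsMarkovKernel κ] (m : Measure β)
    [IsProbabilityMeasure m] {q : ℕ} (hq : 0 < q) {L : ℝ≥0∞} (hL : L ≠ 0) (hL' : L ≠ ∞) :
    (m.prod volume) {z : β × ℝ | L / q < κ z.1 {quantize q z.2}} ≤ L⁻¹ := by
  have hq0 : (q : ℝ≥0∞) ≠ 0 := by exact_mod_cast hq.ne'
  have hs : MeasurableSet {z : β × ℝ | L / q < κ z.1 {quantize q z.2}} :=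
    measurableSet_lt measurable_const (measurable_kernel_singleton κ measurable_fst
      ((measurable_quantize q).comp measurable_snd))
  rw [Measure.prod_apply hs]
  have hy : ∀ y, volume (Prod.mk y ⁻¹' {z : β × ℝ | L / q < κ z.1 {quantize q z.2}}) ≤ L⁻¹ := by
    intro y
    have hmeas : Measurable (fun u => κ y {quantize q u}) :=
      measurable_kernel_singleton κ measurable_const (measurable_quantize q)
    have h1 := meas_ge_le_lintegral_div (μ := volume) hmeas.aemeasurable
      (ε := L / q) (ENNReal.div_ne_zero.2 ⟨hL, ENNReal.natCast_ne_top q⟩)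
      (ENNReal.div_ne_top hL' hq0)
    have h2 : ∫⁻ u, κ y {quantize q u} ≤ (q : ℝ≥0∞)⁻¹ := by
      rw [lintegral_comp_quantize hq (fun x => κ y {x})]
      calc _ ≤ (q : ℝ≥0∞)⁻¹ * 1 := by
            gcongr
            exact (tsum_grid_le_measure_univ (κ y) hq).trans_eq measure_univ
        _ = _ := mul_one _
    refine le_trans (measure_mono fun u (hu : L / q < κ y {quantize q u}) => hu.le) (h1.trans ?_)
    refine (ENNReal.div_le_div_right h2 _).trans_eq ?_
    rw [ENNReal.div_eq_inv_mul, ENNReal.inv_div (Or.inl (ENNReal.natCast_ne_top q)) (Or.inl hq0),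
      div_eq_mul_inv, mul_right_comm, ENNReal.mul_inv_cancel hq0 (ENNReal.natCast_ne_top q),
      one_mul]
  refine (lintegral_mono hy).trans ?_
  simp

/-- If the joint law of `(Y, U)` on an event `R` is absolutely continuous with respect to
`law(Y) ⊗ volume`, then `H([U]_q | Y)` grows at least like `P(R) log₂ q`. -/
lemma exists_le_discreteCondEntropy_quantize (hU : Measurable U) (hY : Measurable Y) {R : Set Ω}
    (hac : (P.restrict R).map (fun ω => (Y ω, U ω)) ≪ (P.map Y).prod volume)
    {ε : ℝ≥0∞} (hε : ε ≠ 0) :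
    ∃ L : ℝ, 0 < L ∧ ∀ q : ℕ, 0 < q →
      ENNReal.ofReal (Real.logb 2 (q / L)) * (P R - ε) ≤
        discreteCondEntropy P (fun ω => quantize q (U ω)) Y := by
  have : IsProbabilityMeasure (P.map Y) := Measure.isProbabilityMeasure_map hY.aemeasurable
  obtain ⟨d, hd, H⟩ := exists_pos_measure_lt_of_absolutelyContinuous hac hε
  -- With `L = 1/d'` the large atoms occupy measure at most `d'`, which must be strictly below `d`;
  -- also `d` itself may be infinite.
  obtain ⟨d', hd', hdd⟩ := exists_between hd
  have hd'top : d' ≠ ∞ := hdd.ne_top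
  have hd'0 : d' ≠ 0 := hd'.ne'
  have hd'r : 0 < d'.toReal := ENNReal.toReal_pos hd'0 hd'top
  refine ⟨d'.toReal⁻¹, by positivity, fun q hq => ?_⟩
  have hqr : (0 : ℝ) < q := by exact_mod_cast hq
  have hD : Measurable (fun ω => quantize q (U ω)) := (measurable_quantize q).comp hU
  have hLq : ENNReal.ofReal (d'.toReal⁻¹ / q) = d'⁻¹ / q := by
    rw [ENNReal.ofReal_div_of_pos hqr, ENNReal.ofReal_inv_of_pos hd'r,
      ENNReal.ofReal_toReal hd'top, ENNReal.ofReal_natCast]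
  have key := mul_measure_le_discreteCondEntropy (P := P) hD hY
    (Set.countable_range (fun k : ℤ => (k : ℝ) / q)) (fun ω => quantize_mem_range q (U ω))
    (l := d'.toReal⁻¹ / q)
  rw [inv_div] at key
  refine le_trans (mul_le_mul_right ?_ _) key
  rw [hLq]
  set κ := condDistrib (fun ω => quantize q (U ω)) Y P
  set A : Set (β × ℝ) := {z | d'⁻¹ / q < κ z.1 {quantize q z.2}}
  have hA : MeasurableSet A :=
    measurableSet_lt measurable_const (measurable_kernel_singleton κ measurable_fst
      ((measurable_quantize q).comp measurable_snd))
  have h1 : ((P.map Y).prod volume) A < d := by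
    refine (prod_measure_large_atom_le κ (P.map Y) hq (ENNReal.inv_ne_zero.2 hd'top)
      (ENNReal.inv_ne_top.2 hd'0)).trans_lt ?_
    rwa [inv_inv]
  have h2 := H A hA h1
  rw [Measure.map_apply (hY.prodMk hU) hA, Measure.restrict_apply ((hY.prodMk hU) hA)] at h2
  rw [tsub_le_iff_right]
  calc P R ≤ P ({ω | κ (Y ω) {quantize q (U ω)} ≤ d'⁻¹ / q} ∪
        ((fun ω => (Y ω, U ω)) ⁻¹' A ∩ R)) := by
        refine measure_mono fun ω hω => ?_
        by_cases h : κ (Y ω) {quantize q (U ω)} ≤ d'⁻¹ / q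
        · exact Or.inl h
        · exact Or.inr ⟨not_le.1 h, hω⟩
    _ ≤ _ := (measure_union_le _ _).trans (by gcongr)

lemma sq_quantize_le {q : ℕ} (hq : 0 < q) (x : ℝ) : quantize q x ^ 2 ≤ 2 * x ^ 2 + 2 ∧
    x ^ 2 ≤ 2 * quantize q x ^ 2 + 2 := by
  have hqr : (1 : ℝ) ≤ q := by exact_mod_cast hq
  have h1 : quantize q x ≤ x := by
    unfold quantize
    rw [div_le_iff₀ (by linarith), mul_comm]
    exact Int.floor_le _
  have h2 : x ≤ quantize q x + 1 := by
    unfold quantize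
    rw [← sub_le_iff_le_add, le_div_iff₀ (by linarith)]
    have := (Int.lt_floor_add_one ((q : ℝ) * x)).le
    nlinarith
  constructor <;> nlinarith [sq_nonneg (x + (x - quantize q x)),
    sq_nonneg (quantize q x - (x - quantize q x))]

/-- The sum is the integral of `(1 + [u]_q²)⁻¹`, and `1 + u² ≤ 3 (1 + [u]_q²)` dominates it by a
Cauchy integral independent of `q`. -/
lemma exists_tsum_cauchy_weight_le : ∃ G : ℝ≥0∞, G ≠ ∞ ∧ ∀ q : ℕ, 0 < q →
    ∑' k : ℤ, ENNReal.ofReal (q * (1 + ((k : ℝ) / q) ^ 2))⁻¹ ≤ G := by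
  refine ⟨∫⁻ u : ℝ, ENNReal.ofReal (3 * (1 + u ^ 2)⁻¹), ?_, fun q hq => ?_⟩
  · exact (integrable_inv_one_add_sq.const_mul 3).lintegral_lt_top.ne
  have hqr : (0 : ℝ) < q := by exact_mod_cast hq
  have h : ∑' k : ℤ, ENNReal.ofReal (q * (1 + ((k : ℝ) / q) ^ 2))⁻¹ =
      ∫⁻ u, ENNReal.ofReal (1 + quantize q u ^ 2)⁻¹ := by
    rw [lintegral_comp_quantize hq (fun x => ENNReal.ofReal (1 + x ^ 2)⁻¹),
      ← ENNReal.tsum_mul_left]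
    refine tsum_congr fun k => ?_
    rw [mul_inv, ENNReal.ofReal_mul (by positivity), ENNReal.ofReal_inv_of_pos hqr,
      ENNReal.ofReal_natCast]
  rw [h]
  refine lintegral_mono fun u => ENNReal.ofReal_le_ofReal ?_
  rw [← div_eq_mul_inv, inv_eq_one_div, div_le_div_iff₀ (by positivity) (by positivity)]
  have := (sq_quantize_le hq u).2
  nlinarith [sq_nonneg (quantize q u)]

/-- If `U` coincides with one of the values `f t Y` outside an event of probability at most `p`,
then `H([U]_q | Y)` grows at most like `p log₂ q`. -/
lemma exists_discreteCondEntropy_quantize_le (hU : MemLp U 2 P) (hUm : Measurable U)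
    (hY : Measurable Y) {ι : Type*} [Finite ι] (f : ι → β → ℝ) (hf : ∀ t, Measurable (f t)) :
    ∃ C : ℝ≥0∞, C ≠ ∞ ∧ ∀ q : ℕ, 0 < q →
      discreteCondEntropy P (fun ω => quantize q (U ω)) Y ≤
        ENNReal.ofReal (Real.logb 2 q) * P {ω | ∀ t, U ω ≠ f t (Y ω)} + C := by
  classical
  have := Fintype.ofFinite ι
  have hPY : IsProbabilityMeasure (P.map Y) := Measure.isProbabilityMeasure_map hY.aemeasurable
  obtain ⟨G, hG, hGq⟩ := exists_tsum_cauchy_weight_le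
  have hlog2 : 0 < Real.log 2 := Real.log_pos one_lt_two
  refine ⟨∫⁻ ω, ENNReal.ofReal ((2 * U ω ^ 2 + 2) / Real.log 2) ∂P +
    ENNReal.ofReal (Real.log 2)⁻¹ * (Fintype.card ι + G), ?_, fun q hq => ?_⟩
  · refine ENNReal.add_ne_top.2 ⟨?_, by finiteness⟩
    exact ((((hU.integrable_sq).const_mul 2).add (integrable_const 2)).div_const
      _).lintegral_lt_top.ne
  have hqr : (1 : ℝ) ≤ q := by exact_mod_cast hq
  have hD : Measurable (fun ω => quantize q (U ω)) := (measurable_quantize q).comp hUm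
  set κ := condDistrib (fun ω => quantize q (U ω)) Y P
  set S : Set (β × ℝ) := {z | ∃ t, z.2 = quantize q (f t z.1)}
  have hS : MeasurableSet S := by
    have : S = ⋃ t, {z : β × ℝ | z.2 = quantize q (f t z.1)} := by ext; simp [S]
    rw [this]
    exact MeasurableSet.iUnion fun t => measurableSet_eq_fun measurable_snd
      (((measurable_quantize q).comp (hf t)).comp measurable_fst)
  -- The Gibbs weight: the quantized candidates get weight `1` and cost nothing; every other grid
  -- point costs `log₂ q + log₂ (1 + x²)`, whose last term is controlled by the second moment. The
  -- total weight is at most `card ι + G`, uniformly in `q` and `y`.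
  set g : β × ℝ → ℝ := fun z => if z ∈ S then 1 else (q * (1 + z.2 ^ 2))⁻¹
  have hw1 : ∀ x : ℝ, 1 ≤ (q : ℝ) * (1 + x ^ 2) := fun x => by nlinarith [sq_nonneg x]
  have hg0 : ∀ z, 0 < g z := fun z => by
    have := hw1 z.2
    simp only [g]; split_ifs <;> positivity
  have hg1 : ∀ z, g z ≤ 1 := fun z => by
    simp only [g]; split_ifs
    · exact le_rfl
    · exact inv_le_one_of_one_le₀ (hw1 z.2)
  have hgm : Measurable g := Measurable.ite hS measurable_const (by fun_prop)
  have hF : Measurable (fun z => ENNReal.ofReal (Real.logb 2 (g z)⁻¹)) :=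
    ((Real.measurable_log.comp hgm.inv).div_const _).ennreal_ofReal
  have hsum : ∀ y, ∑' x : Set.range (fun k : ℤ => (k : ℝ) / q), ENNReal.ofReal (g (y, x)) ≤
      Fintype.card ι + G := by
    intro y
    calc ∑' x : Set.range (fun k : ℤ => (k : ℝ) / q), ENNReal.ofReal (g (y, x))
        ≤ ∑' x : Set.range (fun k : ℤ => (k : ℝ) / q),
          (Set.indicator {x : ℝ | (y, x) ∈ S} 1 (x : ℝ) +
            ENNReal.ofReal (q * (1 + (x : ℝ) ^ 2))⁻¹) := by
          refine ENNReal.tsum_le_tsum fun x => ?_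
          by_cases hx : (y, (x : ℝ)) ∈ S
          · rw [Set.indicator_of_mem (by exact hx)]
            simp [g, hx]
          · simp [g, hx]
      _ ≤ _ := by
          rw [ENNReal.tsum_add]
          refine add_le_add ?_ ?_
          · refine (ENNReal.tsum_comp_le_tsum_of_injective Subtype.val_injective _).trans ?_
            calc ∑' x : ℝ, Set.indicator {x : ℝ | (y, x) ∈ S} (1 : ℝ → ℝ≥0∞) x
                ≤ ∑' x : ℝ, ∑ t, (if x = quantize q (f t y) then (1 : ℝ≥0∞) else 0) := by
                  refine ENNReal.tsum_le_tsum fun x => ?_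
                  by_cases hx : (y, x) ∈ S
                  · obtain ⟨t, ht⟩ := id hx
                    rw [Set.indicator_of_mem (by exact hx)]
                    refine le_trans ?_ (Finset.single_le_sum (fun _ _ => zero_le)
                      (Finset.mem_univ t))
                    simp [show x = quantize q (f t y) from ht]
                  · rw [Set.indicator_of_notMem (by exact hx)]
                    exact zero_le
              _ = Fintype.card ι := by
                  rw [Summable.tsum_finsetSum fun _ _ => ENNReal.summable]
                  simp
          · rw [tsum_range (fun x : ℝ => ENNReal.ofReal (q * (1 + x ^ 2))⁻¹) (grid_injective hq)]
            exact hGq q hq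
  calc discreteCondEntropy P (fun ω => quantize q (U ω)) Y
      ≤ ∫⁻ y, (∫⁻ x, ENNReal.ofReal (Real.logb 2 (g (y, x))⁻¹) ∂(κ y) +
          ENNReal.ofReal (Real.log 2)⁻¹ * (Fintype.card ι + G)) ∂(P.map Y) := by
        refine lintegral_mono_ae ?_
        filter_upwards [condDistrib_compl_eq_zero hD hY
          (Set.countable_range (fun k : ℤ => (k : ℝ) / q)).measurableSet
          (fun ω => quantize_mem_range q (U ω))] with y hy
        refine (entropyOfLaw_le_gibbs _ (Set.countable_range _) hy (fun x => g (y, x))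
          (fun x => hg0 _) (fun x => hg1 _)).trans ?_
        gcongr
        exact hsum y
    _ = ∫⁻ ω, ENNReal.ofReal (Real.logb 2 (g (Y ω, quantize q (U ω)))⁻¹) ∂P +
          ENNReal.ofReal (Real.log 2)⁻¹ * (Fintype.card ι + G) := by
        rw [lintegral_add_right _ measurable_const, lintegral_const, measure_univ, mul_one,
          lintegral_lintegral_condDistrib hD hY hF]
    _ ≤ _ := by
        rw [← add_assoc]
        gcongr
        have hE : MeasurableSet {ω | ∀ t, U ω ≠ f t (Y ω)} := by
          simp only [Set.ofPred_forall]
          exact MeasurableSet.iInter fun t =>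
            (measurableSet_eq_fun hUm ((hf t).comp hY)).compl
        rw [← lintegral_indicator_const hE, ← lintegral_add_left
          (measurable_const.indicator hE)]
        refine lintegral_mono fun ω => ?_
        by_cases hω : (Y ω, quantize q (U ω)) ∈ S
        · simp [g, hω]
        · have hmem : ω ∈ {ω | ∀ t, U ω ≠ f t (Y ω)} := fun t ht => hω ⟨t, by rw [ht]⟩
          simp only [g, hω, if_false, inv_inv]
          rw [Set.indicator_of_mem hmem, ← ENNReal.ofReal_add
            (Real.logb_nonneg one_lt_two hqr) (by positivity)]
          refine ENNReal.ofReal_le_ofReal ?_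
          rw [Real.logb_mul (by positivity) (by positivity)]
          have h1 := (sq_quantize_le hq (U ω)).1
          have h2 := Real.log_le_sub_one_of_pos
            (show (0 : ℝ) < 1 + quantize q (U ω) ^ 2 by positivity)
          gcongr
          unfold Real.logb
          gcongr
          linarith

end Quantize

/-- The conditional information dimension is the probability of an event `R` on which `(Y, U)` is
absolutely continuous with respect to `law(Y) ⊗ volume`, and off which `U` is a function of `Y`
up to finitely many alternatives and an arbitrarily small exceptional probability. -/
lemma tendsto_condRIDRatio {Ω β : Type*} [MeasurableSpace Ω] [MeasurableSpace β] {P : Measure Ω}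
    [IsProbabilityMeasure P] {U : Ω → ℝ} {Y : Ω → β} (hU : MemLp U 2 P) (hUm : Measurable U)
    (hY : Measurable Y) {R : Set Ω}
    (hac : (P.restrict R).map (fun ω => (Y ω, U ω)) ≪ (P.map Y).prod volume)
    (happrox : ∀ ε : ℝ≥0∞, ε ≠ 0 → ∃ (ι : Type) (_ : Finite ι) (f : ι → β → ℝ),
      (∀ t, Measurable (f t)) ∧ P {ω | ∀ t, U ω ≠ f t (Y ω)} ≤ P R + ε) :
    Tendsto (condRIDRatio P U Y) atTop (𝓝 (P R)) := by
  have hlog : Tendsto (fun q : ℕ => ENNReal.ofReal (Real.logb 2 q)) atTop (𝓝 ∞) :=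
    ENNReal.tendsto_ofReal_atTop.comp
      ((Real.tendsto_logb_atTop one_lt_two).comp tendsto_natCast_atTop_atTop)
  have hlogpos : ∀ᶠ q : ℕ in atTop, 0 < Real.logb 2 q := by
    filter_upwards [eventually_ge_atTop 2] with q hq
    exact Real.logb_pos one_lt_two (by exact_mod_cast hq)
  refine tendsto_of_le_liminf_of_limsup_le ?_ ?_
  · refine ENNReal.le_of_forall_pos_le_add fun ε hε _ => ?_
    rw [← tsub_le_iff_right]
    have hε' : (ε : ℝ≥0∞) ≠ 0 := by exact_mod_cast hε.ne'
    obtain ⟨L, hL, H⟩ := exists_le_discreteCondEntropy_quantize hUm hY hac hε'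
    have hlim : Tendsto (fun q : ℕ => ENNReal.ofReal (1 - Real.logb 2 L / Real.logb 2 q) *
        (P R - ε)) atTop (𝓝 (P R - ε)) := by
      have h1 : Tendsto (fun q : ℕ => 1 - Real.logb 2 L / Real.logb 2 q) atTop (𝓝 (1 - 0)) :=
        tendsto_const_nhds.sub (Tendsto.const_div_atTop
          ((Real.tendsto_logb_atTop one_lt_two).comp tendsto_natCast_atTop_atTop) _)
      have h2 := ENNReal.Tendsto.mul_const (b := P R - ε) (ENNReal.tendsto_ofReal h1)
        (Or.inr (ENNReal.sub_ne_top (measure_ne_top _ _)))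
      simpa using h2
    rw [← hlim.liminf_eq]
    refine liminf_le_liminf ?_
    filter_upwards [hlogpos, eventually_gt_atTop 0] with q hq hq0
    have hqr : (0 : ℝ) < q := by exact_mod_cast hq0
    unfold condRIDRatio
    rw [ENNReal.le_div_iff_mul_le (Or.inl (by simpa using hq)) (Or.inl ENNReal.ofReal_ne_top)]
    refine le_trans (le_of_eq ?_) (H q hq0)
    rw [mul_right_comm, ← ENNReal.ofReal_mul' hq.le, Real.logb_div hqr.ne' hL.ne']
    congr 2
    field_simp
  · refine ENNReal.le_of_forall_pos_le_add fun ε hε _ => ?_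
    obtain ⟨ι, hι, f, hf, hp⟩ := happrox ε (by exact_mod_cast hε.ne')
    obtain ⟨C, hC, H⟩ := exists_discreteCondEntropy_quantize_le hU hUm hY f hf
    have hlim : Tendsto (fun q : ℕ => (P R + ε) + C / ENNReal.ofReal (Real.logb 2 q)) atTop
        (𝓝 (P R + ε)) := by
      have := (ENNReal.Tendsto.const_div hlog (Or.inr hC)).const_add (P R + ε)
      simpa using this
    rw [← hlim.limsup_eq]
    refine limsup_le_limsup ?_
    filter_upwards [hlogpos, eventually_gt_atTop 0] with q hq hq0
    have hq' : ENNReal.ofReal (Real.logb 2 q) ≠ 0 := by simpa using hq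
    unfold condRIDRatio
    refine (ENNReal.div_le_div_right (H q hq0) _).trans ?_
    rw [ENNReal.add_div, mul_comm, ENNReal.mul_div_cancel_right hq' ENNReal.ofReal_ne_top]
    gcongr

/-! ### Conditional information dimension of linear forms. -/

lemma Measure.pi_absolutelyContinuous {n : ℕ} {μ m : Fin n → Measure ℝ} [∀ i, SigmaFinite (μ i)]
    [∀ i, SigmaFinite (m i)] (h : ∀ i, μ i ≪ m i) : Measure.pi μ ≪ Measure.pi m := by
  induction n with
  | zero => rw [Measure.pi_of_empty, Measure.pi_of_empty]
  | succ n ih =>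
    have h1 := (measurePreserving_piFinSuccAbove μ 0).symm
    have h2 := (measurePreserving_piFinSuccAbove m 0).symm
    rw [← h1.map_eq, ← h2.map_eq]
    exact ((h 0).prod (ih fun j => h _)).map (MeasurableEquiv.measurable _)

/-- Translation along a direction supported on the coordinates with a density makes the pair
`(y, u)` absolutely continuous when it fixes `y` and moves `u`. -/
lemma absolutelyContinuous_map_of_translation {N : ℕ} {β : Type*} [MeasurableSpace β]
    (ν : Measure ℝ) [IsProbabilityMeasure ν] {S : Set ℝ}
    (hac : ν.restrict Sᶜ ≪ volume) (C : Fin N → Prop) {w : Fin N → ℝ}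
    (hw : ∀ j, ¬ C j → w j = 0) {y : (Fin N → ℝ) → β} {u : (Fin N → ℝ) → ℝ}
    (hy : Measurable y) (hu : Measurable u) (hyw : ∀ x (s : ℝ), y (x + s • w) = y x)
    (huw : ∀ x (s : ℝ), u (x + s • w) = u x + s) :
    ((Measure.pi fun _ => ν).restrict {x | ∀ j, x j ∉ S ↔ C j}).map (fun x => (y x, u x)) ≪
      ((Measure.pi fun _ => ν).map y).prod volume := by
  classical
  -- This reference measure dominates the law on the box and, unlike the law itself, is invariant
  -- under translation along `w`.
  set m : Fin N → Measure ℝ := fun j => if C j then volume else ν with hm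
  have hsf : ∀ j, SigmaFinite (m j) := fun j => by
    simp only [hm]; split_ifs <;> infer_instance
  have hbox : {x : Fin N → ℝ | ∀ j, x j ∉ S ↔ C j} =
      Set.univ.pi (fun j => if C j then Sᶜ else S) := by
    ext x
    simp only [Set.mem_ofPred_eq, Set.mem_univ_pi]
    refine forall_congr' fun j => ?_
    by_cases h : C j <;> simp [h]
  have hres : (Measure.pi fun _ : Fin N => ν).restrict {x | ∀ j, x j ∉ S ↔ C j} ≪
      Measure.pi m := by
    rw [hbox, Measure.restrict_pi_pi]
    refine Measure.pi_absolutelyContinuous fun j => ?_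
    by_cases h : C j
    · simpa [hm, h] using hac
    · simpa [hm, h] using Measure.absolutelyContinuous_of_le Measure.restrict_le_self
  have hmp : ∀ s : ℝ, MeasurePreserving (fun x : Fin N → ℝ => x + s • w) (Measure.pi m)
      (Measure.pi m) := by
    intro s
    refine measurePreserving_pi m m (f := fun j t => t + s * w j) fun j => ?_
    by_cases h : C j
    · simpa [hm, h] using measurePreserving_add_right volume (s * w j)
    · simpa [hm, h, hw j h, Function.id_def] using MeasurePreserving.id ν
  refine Measure.AbsolutelyContinuous.mk fun A hA hA0 => ?_
  rw [Measure.measure_prod_null hA] at hA0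
  have hA0' : ∀ᵐ x ∂(Measure.pi fun _ : Fin N => ν), volume (Prod.mk (y x) ⁻¹' A) = 0 :=
    ae_of_ae_map hy.aemeasurable hA0
  have hGm : MeasurableSet {x | volume (Prod.mk (y x) ⁻¹' A) = 0} :=
    ((measurable_measure_prodMk_left hA).comp hy) (measurableSet_singleton 0)
  -- For each `x` almost every shift `s` is good; by Fubini one `s` is good for almost every `x`,
  -- and invariance of `m` brings it back to `s = 0`. Nullity of the section is part of the
  -- predicate because it is known almost everywhere only for the law, not for `m`.
  have key : ∀ᵐ x ∂(Measure.pi m), ¬ (volume (Prod.mk (y x) ⁻¹' A) = 0 ∧ (y x, u x) ∈ A) := by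
    have hE : MeasurableSet {x | ¬ (volume (Prod.mk (y x) ⁻¹' A) = 0 ∧ (y x, u x) ∈ A)} :=
      (hGm.inter ((hy.prodMk hu) hA)).compl
    have hT : MeasurableSet {z : (Fin N → ℝ) × ℝ |
        ¬ (volume (Prod.mk (y z.1) ⁻¹' A) = 0 ∧ (y z.1, u z.1 + z.2) ∈ A)} :=
      ((hGm.preimage measurable_fst).inter (((hy.comp measurable_fst).prodMk
        ((hu.comp measurable_fst).add measurable_snd)) hA)).compl
    have h1 : ∀ᵐ x ∂(Measure.pi m), ∀ᵐ s : ℝ,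
        ¬ (volume (Prod.mk (y x) ⁻¹' A) = 0 ∧ (y x, u x + s) ∈ A) := by
      refine ae_of_all _ fun x => ?_
      by_cases hx : volume (Prod.mk (y x) ⁻¹' A) = 0
      · have := (measurePreserving_add_left volume (u x)).measure_preimage
          (hA.preimage measurable_prodMk_left).nullMeasurableSet (s := Prod.mk (y x) ⁻¹' A)
        rw [ae_iff]
        simp only [hx, true_and, not_not]
        exact this.trans hx
      · exact ae_of_all _ fun s h => hx h.1
    rw [Measure.ae_ae_comm hT] at h1
    obtain ⟨s, hs⟩ := h1.exists
    rw [← (hmp s).map_eq, ae_map_iff (hmp s).measurable.aemeasurable hE]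
    filter_upwards [hs] with x hx
    rwa [hyw, huw]
  rw [Measure.map_apply (hy.prodMk hu) hA]
  have h3 := hres.ae_le key
  have h4 := ae_restrict_of_ae (s := {x : Fin N → ℝ | ∀ j, x j ∉ S ↔ C j}) hA0'
  refine measure_eq_zero_iff_ae_notMem.2 ?_
  filter_upwards [h3, h4] with x hx hx' hxA using hx ⟨hx', hxA⟩

/-- `K` is not determined by the family `L` on vectors supported on the coordinates in `C`. -/
def Innovates {N : ℕ} {κ : Type*} (K : (Fin N → ℝ) →ₗ[ℝ] ℝ) (L : κ → (Fin N → ℝ) →ₗ[ℝ] ℝ)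
    (C : Fin N → Prop) : Prop :=
  ∃ w : Fin N → ℝ, (∀ j, ¬ C j → w j = 0) ∧ (∀ k, L k w = 0) ∧ K w ≠ 0

/-- Composing with the coordinate projection `R` onto `C`, the failure of innovation says that the
common kernel of the `L k ∘ R` lies in that of `K ∘ R`; by duality `K ∘ R` is in their span. -/
lemma exists_eq_sum_of_not_innovates {N : ℕ} {κ : Type*} [Fintype κ]
    {K : (Fin N → ℝ) →ₗ[ℝ] ℝ} {L : κ → (Fin N → ℝ) →ₗ[ℝ] ℝ} {C : Fin N → Prop}
    (h : ¬ Innovates K L C) :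
    ∃ c : κ → ℝ, ∀ x : Fin N → ℝ, (∀ j, ¬ C j → x j = 0) → K x = ∑ k, c k * L k x := by
  classical
  let R : (Fin N → ℝ) →ₗ[ℝ] (Fin N → ℝ) :=
    LinearMap.pi fun j => if C j then LinearMap.proj j else 0
  have hR : ∀ x j, R x j = if C j then x j else 0 := fun x j => by
    simp only [R, LinearMap.pi_apply]; split_ifs <;> rfl
  have hker : ⨅ k, LinearMap.ker ((L k).comp R) ≤ LinearMap.ker (K.comp R) := by
    intro x hx
    by_contra hK
    refine h ⟨R x, fun j hj => by simp [hR, hj], fun k => ?_, hK⟩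
    exact (Submodule.mem_iInf _).1 hx k
  obtain ⟨c, hc⟩ := (Submodule.mem_span_range_iff_exists_fun ℝ).1 (mem_span_of_iInf_ker_le_ker hker)
  refine ⟨c, fun x hx => ?_⟩
  have hRx : R x = x := by
    ext j
    rw [hR]
    split_ifs with hj
    · rfl
    · exact (hx j hj).symm
  have := LinearMap.congr_fun hc x
  simpa [hRx] using this.symm

/-- Conditional information dimension of a linear form given finitely many linear forms, for an
i.i.d. vector with mixed law: the probability that the form is new on the continuous
coordinates. -/
lemma tendsto_condRIDRatio_linear {Ω : Type*} [MeasurableSpace Ω] {P : Measure Ω}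
    [IsProbabilityMeasure P] {N : ℕ} {V : Ω → Fin N → ℝ} (hV : Measurable V) {ν : Measure ℝ}
    [IsProbabilityMeasure ν] (hlaw : P.map V = Measure.pi fun _ => ν) {S : Set ℝ}
    (hS : S.Countable) (hac : ν.restrict Sᶜ ≪ volume) {κ : Type*} [Fintype κ]
    (K : (Fin N → ℝ) →ₗ[ℝ] ℝ) (L : κ → (Fin N → ℝ) →ₗ[ℝ] ℝ)
    (hU : MemLp (fun ω => K (V ω)) 2 P) :
    Tendsto (condRIDRatio P (fun ω => K (V ω)) (fun ω k => L k (V ω))) atTop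
      (𝓝 (P {ω | Innovates K L (fun j => V ω j ∉ S)})) := by
  classical
  have hSm := hS.measurableSet
  have : Countable S := hS.to_subtype
  have hKm : Measurable K := (LinearMap.continuous_of_finiteDimensional K).measurable
  have hLm : Measurable (fun x k => L k x) := measurable_pi_lambda _ fun k =>
    (LinearMap.continuous_of_finiteDimensional (L k)).measurable
  have hYm : Measurable (fun ω k => L k (V ω)) := hLm.comp hV
  have hUm : Measurable (fun ω => K (V ω)) := hKm.comp hV
  refine tendsto_condRIDRatio hU hUm hYm ?_ ?_
  · refine Measure.AbsolutelyContinuous.mk fun A hA hA0 => ?_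
    rw [Measure.map_apply (hYm.prodMk hUm) hA, Measure.restrict_apply
      ((hYm.prodMk hUm) hA)]
    have hsub : ((fun ω => ((fun k => L k (V ω)), K (V ω))) ⁻¹' A ∩
        {ω | Innovates K L (fun j => V ω j ∉ S)}) ⊆
        ⋃ C : {C : Fin N → Prop // Innovates K L C},
          V ⁻¹' ((fun x => ((fun k => L k x), K x)) ⁻¹' A ∩
          {x | ∀ j, x j ∉ S ↔ C.1 j}) := by
      rintro ω ⟨h1, h2⟩
      exact Set.mem_iUnion.2 ⟨⟨_, h2⟩, h1, fun j => Iff.rfl⟩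
    refine measure_mono_null hsub (measure_iUnion_null fun C => ?_)
    obtain ⟨C, w, hw, hLw, hKw⟩ := C
    -- The innovating vector is rescaled so that `K` moves at unit speed along it.
    have h := absolutelyContinuous_map_of_translation ν hac C (w := (K w)⁻¹ • w)
      (fun j hj => by simp [hw j hj]) hLm hKm
      (fun x s => by ext k; simp [hLw]) (fun x s => by simp [hKw])
    rw [← hlaw, Measure.map_map hLm hV] at h
    have hbox : MeasurableSet {x : Fin N → ℝ | ∀ j, x j ∉ S ↔ C j} := by
      rw [Set.ofPred_forall]
      refine MeasurableSet.iInter fun j => ?_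
      have hj' : Measurable (fun x : Fin N → ℝ => x j) := measurable_pi_apply j
      by_cases hj : C j
      · simp only [hj, iff_true]
        exact hj' hSm.compl
      · simp only [hj, iff_false, not_not]
        exact hj' hSm
    have h0 := h hA0
    rwa [Measure.map_apply (hLm.prodMk hKm) hA, Measure.restrict_apply ((hLm.prodMk hKm) hA),
      Measure.map_apply hV (((hLm.prodMk hKm) hA).inter hbox)] at h0
  · intro ε hε
    -- The code records the values of the discrete coordinates and `none` at the continuous ones.
    -- There are countably many codes, and subtracting the recorded values leaves a vector supported
    -- on the continuous coordinates.
    let code : Ω → Fin N → Option S := fun ω j => if h : V ω j ∈ S then some ⟨V ω j, h⟩ else none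
    let T₀ := {t : Fin N → Option S // ¬ Innovates K L (fun j => t j = none)}
    have hcode : ∀ ω j, code ω j = none ↔ V ω j ∉ S := fun ω j => by
      simp only [code]; split_ifs with h <;> simp [h]
    have hcode' : ∀ ω j, V ω j ∈ S → ((code ω j).elim 0 Subtype.val : ℝ) = V ω j := fun ω j h => by
      simp [code, h]
    choose c hc using fun t : T₀ => exists_eq_sum_of_not_innovates t.2
    let d : T₀ → Fin N → ℝ := fun t j => (t.1 j).elim 0 Subtype.val
    let f : T₀ → (κ → ℝ) → ℝ := fun t y =>
      ∑ k, c t k * y k + (K (d t) - ∑ k, c t k * L k (d t))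
    have hf : ∀ t, Measurable (f t) := fun t => by fun_prop
    have hfeq : ∀ (t : T₀) ω, code ω = t.1 → K (V ω) = f t (fun k => L k (V ω)) := by
      intro t ω ht
      have := hc t (V ω - d t) (fun j hj => by
        have hj' : V ω j ∈ S := by
          by_contra h
          exact hj (by rw [← ht]; exact (hcode ω j).2 h)
        simp only [Pi.sub_apply, d, ← ht]
        rw [hcode' ω j hj', sub_self])
      simp only [map_sub, mul_sub, Finset.sum_sub_distrib] at this
      simp only [f]
      linarith
    have hfib : ∀ t : Fin N → Option S, MeasurableSet (code ⁻¹' {t}) := by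
      intro t
      have : code ⁻¹' {t} = ⋂ j, {ω | code ω j = t j} := by
        ext ω; simp [funext_iff]
      rw [this]
      refine MeasurableSet.iInter fun j => ?_
      have hVj : Measurable (fun ω => V ω j) := (measurable_pi_apply j).comp hV
      cases htj : t j with
      | none =>
        simp only [hcode]
        exact hVj hSm.compl
      | some a =>
        have : {ω | code ω j = some a} = (fun ω => V ω j) ⁻¹' {(a : ℝ)} := by
          ext ω
          simp only [code, Set.mem_ofPred_eq, Set.mem_preimage, Set.mem_singleton_iff]
          split_ifs with h
          · simp [Subtype.ext_iff]
          · simp only [false_iff]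
            intro h'
            exact h (h' ▸ a.2)
        rw [this]
        exact hVj (measurableSet_singleton _)
    -- Summability lets a finite set `F` of codes carry all but `ε` of the probability without
    -- innovation.
    have hsum : ∑' t : T₀, P (code ⁻¹' {t.1}) ≠ ∞ := by
      rw [← measure_iUnion (fun a b hab => ?_) fun t : T₀ => hfib t.1]
      · exact measure_ne_top _ _
      · refine Disjoint.preimage _ ?_
        simpa using fun h => hab (Subtype.ext h)
    have htail := ENNReal.tendsto_tsum_compl_atTop_zero hsum
    obtain ⟨F, hF⟩ := ((tendsto_order.1 htail).2 ε (pos_iff_ne_zero.2 hε)).exists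
    refine ⟨F, inferInstance, fun t => f t, fun t => hf t, ?_⟩
    calc _ ≤ P ({ω | Innovates K L (fun j => V ω j ∉ S)} ∪
          ⋃ t : {t : T₀ // t ∉ F}, code ⁻¹' {t.1.1}) := by
          refine measure_mono fun ω hω => ?_
          by_cases h : Innovates K L (fun j => V ω j ∉ S)
          · exact Or.inl h
          · right
            have h' : ¬ Innovates K L (fun j => code ω j = none) := by
              simpa only [hcode] using h
            refine Set.mem_iUnion.2 ⟨⟨⟨code ω, h'⟩, fun hmem => ?_⟩, rfl⟩
            exact hω ⟨_, hmem⟩ (hfeq ⟨code ω, h'⟩ ω rfl)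
      _ ≤ _ := by
          refine (measure_union_le _ _).trans ?_
          gcongr
          exact (measure_iUnion_le _).trans hF.le

/-! ### Innovation along the Hadamard recursion -/

/-- The entry is a product of signs over the binary digits of `i` and `j`, so the last digit can be
stripped instead of the leading one. The last digit is the one that `pathIndex` appends. -/
lemma hadamardEntry_interleave (n : ℕ) : ∀ i j : ℕ, i < 2 ^ n → j < 2 ^ n → ∀ a b : Bool,
    hadamardEntry (n + 1) (2 * i + a.toNat) (2 * j + b.toNat) =
      (if a && b then -1 else 1) * hadamardEntry n i j := by
  induction n with
  | zero =>
    intro i j hi hj a b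
    obtain rfl : i = 0 := by simpa using hi
    obtain rfl : j = 0 := by simpa using hj
    cases a <;> cases b <;> simp [hadamardEntry]
  | succ n ih =>
    intro i j hi hj a b
    have hmod : ∀ (k : ℕ) (c : Bool), (2 * k + c.toNat) % 2 ^ (n + 1) =
        2 * (k % 2 ^ n) + c.toNat := by
      intro k c
      have hc := Bool.toNat_le c
      have hk := Nat.div_add_mod k (2 ^ n)
      have hlt := Nat.mod_lt k (Nat.two_pow_pos n)
      rw [pow_succ]
      conv_lhs => rw [← hk]
      rw [show 2 * (2 ^ n * (k / 2 ^ n) + k % 2 ^ n) + c.toNat =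
        (2 * (k % 2 ^ n) + c.toNat) + 2 ^ n * 2 * (k / 2 ^ n) by ring, Nat.add_mul_mod_self_left]
      exact Nat.mod_eq_of_lt (by omega)
    have hle : ∀ (k : ℕ) (c : Bool), 2 ^ (n + 1) ≤ 2 * k + c.toNat ↔ 2 ^ n ≤ k := by
      intro k c
      have hc := Bool.toNat_le c
      rw [pow_succ]
      omega
    rw [hadamardEntry, hmod, hmod,
      ih _ _ (Nat.mod_lt _ (Nat.two_pow_pos n)) (Nat.mod_lt _ (Nat.two_pow_pos n)), hadamardEntry]
    simp only [hle]
    ring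

/-- The `i`-th row of the Hadamard matrix of order `2 ^ n` applied to the start of `w`. -/
def hadamardRow (n i : ℕ) (w : ℕ → ℝ) : ℝ :=
  ∑ j ∈ Finset.range (2 ^ n), hadamardEntry n i j * w j

lemma sum_range_two_mul (m : ℕ) (f : ℕ → ℝ) : ∑ j ∈ Finset.range (2 * m), f j =
    ∑ j ∈ Finset.range m, f (2 * j) + ∑ j ∈ Finset.range m, f (2 * j + 1) := by
  induction m with
  | zero => simp
  | succ m ih =>
    rw [show 2 * (m + 1) = 2 * m + 1 + 1 by ring, Finset.sum_range_succ, Finset.sum_range_succ, ih,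
      Finset.sum_range_succ, Finset.sum_range_succ]
    ring

lemma hadamardRow_succ (n : ℕ) {i : ℕ} (hi : i < 2 ^ n) (a : Bool) (w : ℕ → ℝ) :
    hadamardRow (n + 1) (2 * i + a.toNat) w = hadamardRow n i (fun j => w (2 * j)) +
      (if a then -1 else 1) * hadamardRow n i (fun j => w (2 * j + 1)) := by
  unfold hadamardRow
  rw [pow_succ, mul_comm (2 ^ n) 2, sum_range_two_mul, Finset.mul_sum]
  congr 1
  · refine Finset.sum_congr rfl fun j hj => ?_
    have := hadamardEntry_interleave n i j hi (Finset.mem_range.1 hj) a false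
    simp only [Bool.toNat_false, add_zero, Bool.and_false] at this
    rw [this]
    simp
  · refine Finset.sum_congr rfl fun j hj => ?_
    have := hadamardEntry_interleave n i j hi (Finset.mem_range.1 hj) a true
    simp only [Bool.toNat_true, Bool.and_true] at this
    rw [this, mul_assoc]

/-- The `i`-th Hadamard coefficient is not determined by the previous ones on vectors supported
on `{j | c j}`. -/
def HadamardInnovates (n i : ℕ) (c : ℕ → Prop) : Prop :=
  ∃ w : ℕ → ℝ, (∀ j, ¬ c j → w j = 0) ∧ (∀ k < i, hadamardRow n k w = 0) ∧ hadamardRow n i w ≠ 0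

lemma hadamardRow_congr {n i : ℕ} {v w : ℕ → ℝ} (h : ∀ j < 2 ^ n, v j = w j) :
    hadamardRow n i v = hadamardRow n i w :=
  Finset.sum_congr rfl fun j hj => by rw [h j (Finset.mem_range.1 hj)]

lemma hadamardRow_smul (n i : ℕ) (a : ℝ) (w : ℕ → ℝ) :
    hadamardRow n i (fun j => a * w j) = a * hadamardRow n i w := by
  unfold hadamardRow
  rw [Finset.mul_sum]
  exact Finset.sum_congr rfl fun j _ => by ring

lemma HadamardInnovates.congr {n i : ℕ} {c c' : ℕ → Prop} (h : ∀ j < 2 ^ n, c j → c' j) :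
    HadamardInnovates n i c → HadamardInnovates n i c' := by
  classical
  rintro ⟨w, hw, h0, h1⟩
  have hE : ∀ k, hadamardRow n k (fun j => if j < 2 ^ n then w j else 0) = hadamardRow n k w :=
    fun k => hadamardRow_congr fun j hj => if_pos hj
  refine ⟨fun j => if j < 2 ^ n then w j else 0, fun j hj => ?_, fun k hk => ?_, ?_⟩
  · dsimp only
    split_ifs with hjn
    · exact hw j fun hc => hj (h j hjn hc)
    · rfl
  · rw [hE, h0 k hk]
  · rwa [hE]

/-- Rows `2k` and `2k+1` are the sum and difference of the two half-rows `k`; both vanish exactly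
when both half-rows do. -/
lemma hadamardRow_succ_eq_zero_iff {n i : ℕ} (hi : i ≤ 2 ^ n) (w : ℕ → ℝ) :
    (∀ k < 2 * i, hadamardRow (n + 1) k w = 0) ↔
      ∀ k < i, hadamardRow n k (fun j => w (2 * j)) = 0 ∧
        hadamardRow n k (fun j => w (2 * j + 1)) = 0 := by
  constructor
  · intro h k hk
    have h0 := h (2 * k + false.toNat) (by simp; omega)
    have h1 := h (2 * k + true.toNat) (by simp; omega)
    rw [hadamardRow_succ n (by omega)] at h0 h1
    simp only [Bool.false_eq_true, if_false, if_true, one_mul, neg_mul] at h0 h1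
    constructor <;> linarith
  · intro h k hk
    have hk2 : k = 2 * (k / 2) + (decide (k % 2 = 1)).toNat := by
      rcases Nat.mod_two_eq_zero_or_one k with h | h <;> simp [h] <;> omega
    obtain ⟨h0, h1⟩ := h (k / 2) (by omega)
    rw [hk2, hadamardRow_succ n (by omega), h0, h1]
    simp

/-- The vector with even part `u` and odd part `v`. -/
def interleave (u v : ℕ → ℝ) (j : ℕ) : ℝ := if j % 2 = 0 then u (j / 2) else v (j / 2)

lemma interleave_even (u v : ℕ → ℝ) (j : ℕ) : interleave u v (2 * j) = u j := by
  simp [interleave]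

lemma interleave_odd (u v : ℕ → ℝ) (j : ℕ) : interleave u v (2 * j + 1) = v j := by
  have h1 : (2 * j + 1) % 2 = 1 := by omega
  have h2 : (2 * j + 1) / 2 = j := by omega
  simp [interleave, h1, h2]

lemma interleave_eq_zero {c : ℕ → Prop} {u v : ℕ → ℝ} (hu : ∀ j, ¬ c (2 * j) → u j = 0)
    (hv : ∀ j, ¬ c (2 * j + 1) → v j = 0) (j : ℕ) (hj : ¬ c j) : interleave u v j = 0 := by
  rcases Nat.even_or_odd' j with ⟨k, rfl | rfl⟩
  · rw [interleave_even, hu k hj]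
  · rw [interleave_odd, hv k hj]

/-- The halves of `w` can be chosen independently, so the sum of the two half-coefficients can be
made nonzero as soon as one of them can. -/
lemma hadamardInnovates_plus {n i : ℕ} (hi : i < 2 ^ n) (c : ℕ → Prop) :
    HadamardInnovates (n + 1) (2 * i) c ↔
      HadamardInnovates n i (fun j => c (2 * j)) ∨
        HadamardInnovates n i (fun j => c (2 * j + 1)) := by
  have hrow : ∀ w, hadamardRow (n + 1) (2 * i) w = hadamardRow n i (fun j => w (2 * j)) +
      hadamardRow n i (fun j => w (2 * j + 1)) := fun w => by
    simpa using hadamardRow_succ n hi false w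
  have hz : ∀ k, hadamardRow n k (fun _ => 0) = 0 := fun k => by simp [hadamardRow]
  constructor
  · rintro ⟨w, hw, h0, h1⟩
    rw [hadamardRow_succ_eq_zero_iff hi.le] at h0
    rw [hrow] at h1
    by_cases h : hadamardRow n i (fun j => w (2 * j)) = 0
    · exact Or.inr ⟨_, fun j hj => hw _ hj, fun k hk => (h0 k hk).2, by simpa [h] using h1⟩
    · exact Or.inl ⟨_, fun j hj => hw _ hj, fun k hk => (h0 k hk).1, h⟩
  · rintro (⟨w, hw, h0, h1⟩ | ⟨w, hw, h0, h1⟩)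
    · refine ⟨interleave w (fun _ => 0), interleave_eq_zero hw fun _ _ => rfl, ?_, ?_⟩
      · rw [hadamardRow_succ_eq_zero_iff hi.le]
        intro k hk
        simp only [interleave_even, interleave_odd]
        exact ⟨h0 k hk, hz k⟩
      · rw [hrow]
        simp only [interleave_even, interleave_odd, hz, add_zero]
        exact h1
    · refine ⟨interleave (fun _ => 0) w, interleave_eq_zero (fun _ _ => rfl) hw, ?_, ?_⟩
      · rw [hadamardRow_succ_eq_zero_iff hi.le]
        intro k hk
        simp only [interleave_even, interleave_odd]
        exact ⟨hz k, h0 k hk⟩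
      · rw [hrow]
        simp only [interleave_even, interleave_odd, hz, zero_add]
        exact h1

/-- The past now includes the sum of the half-coefficients. If the sum is zero and the difference is
not, they are opposite and both nonzero. -/
lemma hadamardInnovates_minus {n i : ℕ} (hi : i < 2 ^ n) (c : ℕ → Prop) :
    HadamardInnovates (n + 1) (2 * i + 1) c ↔
      HadamardInnovates n i (fun j => c (2 * j)) ∧
        HadamardInnovates n i (fun j => c (2 * j + 1)) := by
  have hrow : ∀ w, hadamardRow (n + 1) (2 * i) w = hadamardRow n i (fun j => w (2 * j)) +
      hadamardRow n i (fun j => w (2 * j + 1)) := fun w => by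
    simpa using hadamardRow_succ n hi false w
  have hrow' : ∀ w, hadamardRow (n + 1) (2 * i + 1) w = hadamardRow n i (fun j => w (2 * j)) -
      hadamardRow n i (fun j => w (2 * j + 1)) := fun w => by
    simpa [sub_eq_add_neg] using hadamardRow_succ n hi true w
  have hsplit : ∀ w, (∀ k < 2 * i + 1, hadamardRow (n + 1) k w = 0) ↔
      (∀ k < 2 * i, hadamardRow (n + 1) k w = 0) ∧ hadamardRow (n + 1) (2 * i) w = 0 := by
    intro w
    simp only [Nat.lt_succ_iff_lt_or_eq, or_imp, forall_and, forall_eq]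
  constructor
  · rintro ⟨w, hw, h0, h1⟩
    rw [hsplit, hadamardRow_succ_eq_zero_iff hi.le, hrow] at h0
    rw [hrow'] at h1
    obtain ⟨h0, h2⟩ := h0
    exact ⟨⟨_, fun j hj => hw _ hj, fun k hk => (h0 k hk).1, fun h => h1 (by linarith)⟩,
      ⟨_, fun j hj => hw _ hj, fun k hk => (h0 k hk).2, fun h => h1 (by linarith)⟩⟩
  · rintro ⟨⟨u, hu, hu0, hu1⟩, ⟨v, hv, hv0, hv1⟩⟩
    set a := hadamardRow n i u
    set b := hadamardRow n i v
    -- The scaling gives half-coefficients `ab` and `-ab`: zero sum and difference `2ab ≠ 0`.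
    refine ⟨interleave (fun j => b * u j) (fun j => -a * v j), interleave_eq_zero
      (fun j hj => by simp [hu j hj]) (fun j hj => by simp [hv j hj]), ?_, ?_⟩
    · rw [hsplit, hadamardRow_succ_eq_zero_iff hi.le, hrow]
      simp only [interleave_even, interleave_odd, hadamardRow_smul]
      refine ⟨fun k hk => by simp [hu0 k hk, hv0 k hk], ?_⟩
      simp only [a, b]
      ring
    · rw [hrow']
      simp only [interleave_even, interleave_odd, hadamardRow_smul]
      have : b * a - -a * b = 2 * (a * b) := by ring
      rw [this]
      exact mul_ne_zero two_ne_zero (mul_ne_zero hu1 hv1)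

lemma erasureProcess_mem_Icc {α : ℝ} (hα : α ∈ Set.Icc (0 : ℝ) 1) (b : ℕ → Bool) (n : ℕ) :
    erasureProcess α b n ∈ Set.Icc (0 : ℝ) 1 := by
  induction n with
  | zero => exact hα
  | succ n ih =>
    obtain ⟨h0, h1⟩ := ih
    rw [erasureProcess]
    split_ifs <;> constructor <;> nlinarith

/-- For i.i.d. Bernoulli supports, the innovation probabilities follow the erasure process. -/
lemma measureReal_hadamardInnovates {Ω : Type*} [MeasurableSpace Ω] {P : Measure Ω}
    [IsProbabilityMeasure P] {δ : ℝ} (b : ℕ → Bool) (n : ℕ) : ∀ (ξ : ℕ → Ω → Prop),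
    (∀ j, Measurable (ξ j)) → iIndepFun ξ P → (∀ j, P.real {ω | ξ j ω} = δ) →
    P.real {ω | HadamardInnovates n (pathIndex b n) (fun j => ξ j ω)} = erasureProcess δ b n := by
  classical
  -- The event depends on finitely many supports, so it is pulled back from a finite space; this is
  -- what makes the even and odd events independent below.
  have hmeas : ∀ (n i : ℕ) (ξ : ℕ → Ω → Prop), (∀ j, Measurable (ξ j)) →
      ∀ (g : ℕ → ℕ) (S : Finset ℕ), (∀ j < 2 ^ n, g j ∈ S) →
      ∃ A : Set (S → Prop), MeasurableSet A ∧
        {ω | HadamardInnovates n i (fun j => ξ (g j) ω)} = (fun ω (k : S) => ξ k ω) ⁻¹' A := by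
    intro n i ξ hξ g S hS
    refine ⟨{x | HadamardInnovates n i (fun j => ∃ h : g j ∈ S, x ⟨g j, h⟩)},
      (Set.toFinite _).measurableSet, ?_⟩
    ext ω
    exact ⟨HadamardInnovates.congr fun j hj h => ⟨hS j hj, h⟩,
      HadamardInnovates.congr fun j hj ⟨_, h⟩ => h⟩
  induction n with
  | zero =>
    intro ξ hξ hind hδ
    rw [erasureProcess, ← hδ 0]
    congr 1
    ext ω
    have hrow : ∀ w, hadamardRow 0 0 w = w 0 := fun w => by simp [hadamardRow, hadamardEntry]
    constructor
    · rintro ⟨w, hw, -, h1⟩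
      by_contra h
      exact h1 ((hrow w).trans (hw 0 h))
    · intro h
      refine ⟨fun j => if j = 0 then 1 else 0, fun j hj => if_neg ?_, fun k hk => ?_, ?_⟩
      · rintro rfl
        exact hj h
      · simp [pathIndex] at hk
      · exact (hrow _).trans_ne (by simp)
  | succ n ih =>
    intro ξ hξ hind hδ
    have he : Function.Injective (fun j : ℕ => 2 * j) := fun a b h => by simpa using h
    have ho : Function.Injective (fun j : ℕ => 2 * j + 1) := fun a b h => by simpa using h
    have h0 := ih (fun j => ξ (2 * j)) (fun j => hξ _) (hind.precomp he) (fun j => hδ _)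
    have h1 := ih (fun j => ξ (2 * j + 1)) (fun j => hξ _) (hind.precomp ho) (fun j => hδ _)
    set i : ℕ := (pathIndex b n).val with hi_def
    have hi : i < 2 ^ n := (pathIndex b n).isLt
    let S := (Finset.range (2 ^ n)).image (fun j => 2 * j)
    let T := (Finset.range (2 ^ n)).image (fun j => 2 * j + 1)
    have hST : Disjoint S T := by
      rw [Finset.disjoint_left]
      intro k hk hk'
      obtain ⟨a, -, rfl⟩ := Finset.mem_image.1 hk
      obtain ⟨c, -, h⟩ := Finset.mem_image.1 hk'
      omega
    obtain ⟨A, hA, hEA⟩ := hmeas n i ξ hξ (fun j => 2 * j) S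
      (fun j hj => Finset.mem_image_of_mem _ (Finset.mem_range.2 hj))
    obtain ⟨A', hA', hEA'⟩ := hmeas n i ξ hξ (fun j => 2 * j + 1) T
      (fun j hj => Finset.mem_image_of_mem (fun j => 2 * j + 1) (Finset.mem_range.2 hj))
    set E := {ω | HadamardInnovates n i (fun j => ξ (2 * j) ω)}
    set E' := {ω | HadamardInnovates n i (fun j => ξ (2 * j + 1) ω)}
    have hE' : MeasurableSet E' := by
      rw [hEA']
      exact measurableSet_preimage (measurable_pi_lambda _ fun k : T => hξ k) hA'
    have hinter : P.real (E ∩ E') = P.real E * P.real E' := by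
      have := (hind.indepFun_finset S T hST hξ).measure_inter_preimage_eq_mul A A' hA hA'
      rw [← hEA, ← hEA'] at this
      simp [Measure.real, this]
    have hunion := measureReal_union_add_inter (μ := P) (s := E) hE'
    rw [erasureProcess]
    cases hb : b n with
    | true =>
      have hidx : ((pathIndex b (n + 1) : Fin (2 ^ (n + 1))) : ℕ) = 2 * i + 1 := by
        simp [pathIndex, hb, hi_def]
      rw [hidx]
      simp only [hadamardInnovates_minus hi, if_true]
      change P.real (E ∩ E') = _
      rw [hinter, h0, h1, sq]
    | false =>
      have hidx : ((pathIndex b (n + 1) : Fin (2 ^ (n + 1))) : ℕ) = 2 * i := by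
        simp [pathIndex, hb, hi_def]
      rw [hidx]
      simp only [hadamardInnovates_plus hi, Bool.false_eq_true, if_false]
      change P.real (E ∪ E') = _
      rw [hinter, h0, h1] at hunion
      linarith

/-! ### From the mixed law to the dimensions `I_n(i)`. -/

/-- `S` is the countable carrier of the discrete part; being Lebesgue null, it is also null for the
continuous part. -/
lemma IsNonsingularMixture.exists_countable {ν : Measure ℝ} {δ : ℝ}
    (h : IsNonsingularMixture ν δ) :
    ∃ S : Set ℝ, S.Countable ∧ ν.restrict Sᶜ ≪ volume ∧ ν.real Sᶜ = δ := by
  obtain ⟨⟨h0, h1⟩, pd, pc, hpd, hpc, ⟨S, hS, hdS⟩, hac, rfl⟩ := h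
  have hcS : pc S = 0 := hac (hS.measure_zero volume)
  have hcS' : pc Sᶜ = 1 := by
    rw [prob_compl_eq_one_iff hS.measurableSet, hcS]
  refine ⟨S, hS, ?_, ?_⟩
  · rw [Measure.restrict_add, Measure.restrict_smul, Measure.restrict_smul,
      Measure.restrict_eq_zero.2 hdS, smul_zero, zero_add]
    exact ((Measure.absolutelyContinuous_of_le Measure.restrict_le_self).trans hac).smul_left _
  · simp [Measure.real, hdS, hcS', h0]

/-- The Hadamard matrix acting on its `i`-th output coordinate. -/
def hadamardForm (n : ℕ) (i : Fin (2 ^ n)) : (Fin (2 ^ n) → ℝ) →ₗ[ℝ] ℝ :=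
  (LinearMap.proj i).comp (hadamardMatrix n).mulVecLin

lemma hadamardForm_eq_row (n : ℕ) (i : Fin (2 ^ n)) (w : ℕ → ℝ) :
    hadamardForm n i (fun j => w j) = hadamardRow n i w := by
  simp [hadamardForm, hadamardRow, hadamardMatrix, Matrix.mulVec, dotProduct, Finset.sum_range]

lemma innovates_hadamardForm_iff (n : ℕ) (i : Fin (2 ^ n)) (c : ℕ → Prop) :
    Innovates (hadamardForm n i) (fun k : Set.Iio i => hadamardForm n k) (fun j => c j) ↔
      HadamardInnovates n i c := by
  constructor
  · rintro ⟨w, hw, h0, h1⟩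
    set w' : ℕ → ℝ := fun j => if h : j < 2 ^ n then w ⟨j, h⟩ else 0 with hw'
    have hww : (fun j : Fin (2 ^ n) => w' j) = w := by ext j; simp [hw']
    refine ⟨w', fun j hj => ?_, fun k hk => ?_, ?_⟩
    · simp only [hw']
      split_ifs with h
      · exact hw ⟨j, h⟩ hj
      · rfl
    · have := h0 ⟨⟨k, hk.trans i.isLt⟩, hk⟩
      rwa [← hww, hadamardForm_eq_row] at this
    · rwa [← hww, hadamardForm_eq_row] at h1
  · rintro ⟨w, hw, h0, h1⟩
    refine ⟨fun j => w j, fun j hj => hw j hj, fun k => ?_, ?_⟩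
    · rw [hadamardForm_eq_row]
      exact h0 _ k.2
    · rwa [hadamardForm_eq_row]

/-- The conditional law is almost surely constant. It serves to remove the empty past at level `0`.
-/
lemma discreteCondEntropy_of_indepFun {Ω β : Type*} [MeasurableSpace Ω] [MeasurableSpace β]
    {P : Measure Ω} [IsProbabilityMeasure P] {D : Ω → ℝ} {Y : Ω → β} (hD : Measurable D)
    (hY : Measurable Y) (h : IndepFun Y D P) :
    discreteCondEntropy P D Y = discreteEntropy P D := by
  have : IsProbabilityMeasure (P.map Y) := Measure.isProbabilityMeasure_map hY.aemeasurable
  have h1 := condDistrib_ae_eq_of_measure_eq_compProd (μ := P) Y hD.aemeasurable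
    (κ := Kernel.const β (P.map D)) (by
      rw [Measure.compProd_const]
      exact h.map_prod_eq_prod_map_map hY.aemeasurable hD.aemeasurable)
  unfold discreteCondEntropy discreteEntropy
  calc _ = ∫⁻ _, entropyOfLaw (P.map D) ∂(P.map Y) := by
        refine lintegral_congr_ae ?_
        filter_upwards [h1] with y hy
        rw [hy, Kernel.const_apply]
    _ = _ := by simp

section Source

variable {Ω : Type*} [MeasurableSpace Ω] {P : Measure Ω} [IsProbabilityMeasure P]
  {X : ℕ → Ω → ℝ}

lemma tendsto_condRIDRatio_hadamard (hXmeas : ∀ i, Measurable (X i)) (hXindep : iIndepFun X P)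
    (hXident : ∀ i, IdentDistrib (X i) (X 0) P P) (hXmom : MemLp (X 0) 2 P) {S : Set ℝ}
    (hS : S.Countable) (hac : (P.map (X 0)).restrict Sᶜ ≪ volume) (n : ℕ) (i : Fin (2 ^ n)) :
    Tendsto (condRIDRatio P (hadamardTransform X n i) (hadamardPast X n i)) atTop
      (𝓝 (P {ω | HadamardInnovates n i (fun j => X j ω ∉ S)})) := by
  have : IsProbabilityMeasure (P.map (X 0)) :=
    Measure.isProbabilityMeasure_map (hXmeas 0).aemeasurable
  have hV : Measurable (fun ω (j : Fin (2 ^ n)) => X j ω) :=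
    measurable_pi_lambda _ fun j => hXmeas j
  have hlaw : P.map (fun ω (j : Fin (2 ^ n)) => X j ω) = Measure.pi fun _ => P.map (X 0) := by
    have h := (iIndepFun_iff_map_fun_eq_pi_map (fun j : Fin (2 ^ n) =>
      (hXmeas j).aemeasurable)).1 (hXindep.precomp Fin.val_injective)
    rw [h]
    congr 1
    ext1 j
    exact (hXident j).map_eq
  have hU : MemLp (fun ω => hadamardForm n i (fun j => X j ω)) 2 P := by
    have h : (fun ω => hadamardForm n i (fun j => X j ω)) =
        fun ω => ∑ j, hadamardMatrix n i j * X j ω := by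
      ext ω; simp [hadamardForm, Matrix.mulVec, dotProduct]
    rw [h]
    exact memLp_finsetSum _ fun j _ => ((hXident j).memLp_iff.2 hXmom).const_mul _
  have h := tendsto_condRIDRatio_linear hV hlaw hS hac (hadamardForm n i)
    (fun k : Set.Iio i => hadamardForm n k) hU
  have hset : {ω | HadamardInnovates n i (fun j => X j ω ∉ S)} =
      {ω | Innovates (hadamardForm n i) (fun k : Set.Iio i => hadamardForm n k)
        (fun j => X j ω ∉ S)} := by
    ext ω
    exact (innovates_hadamardForm_iff n i (fun j => X j ω ∉ S)).symm
  rw [hset]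
  exact h

lemma hadamardRID_eq_erasureProcess (hXmeas : ∀ i, Measurable (X i)) (hXindep : iIndepFun X P)
    (hXident : ∀ i, IdentDistrib (X i) (X 0) P P) (hXmom : MemLp (X 0) 2 P) {δ : ℝ}
    (hXlaw : IsNonsingularMixture (P.map (X 0)) δ) (b : ℕ → Bool) (n : ℕ) :
    hadamardRID P X n (pathIndex b n) = erasureProcess δ b n := by
  obtain ⟨S, hS, hac, hδ⟩ := hXlaw.exists_countable
  have hlim := tendsto_condRIDRatio_hadamard hXmeas hXindep hXident hXmom hS hac n (pathIndex b n)
  unfold hadamardRID condRID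
  rw [hlim.limUnder_eq]
  have hSc : Measurable (fun x : ℝ => x ∉ S) := hS.measurableSet.mem.not
  refine measureReal_hadamardInnovates b n (fun j ω => X j ω ∉ S)
    (fun j => hSc.comp (hXmeas j)) (hXindep.comp (fun _ x => x ∉ S) fun _ => hSc) fun j => ?_
  rw [← hδ, ← (hXident j).map_eq, map_measureReal_apply (hXmeas j) hS.measurableSet.compl]
  rfl

/-- The unconditional case is `n = 0`: the transform is `X 0` itself and its past is empty. -/
lemma tendsto_ridRatio (hXmeas : ∀ i, Measurable (X i)) (hXindep : iIndepFun X P)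
    (hXident : ∀ i, IdentDistrib (X i) (X 0) P P) (hXmom : MemLp (X 0) 2 P) {δ : ℝ}
    (hXlaw : IsNonsingularMixture (P.map (X 0)) δ) :
    Tendsto (ridRatio P (X 0)) atTop (𝓝 (ENNReal.ofReal δ)) := by
  obtain ⟨S, hS, hac, hδ⟩ := hXlaw.exists_countable
  have hlim := tendsto_condRIDRatio_hadamard hXmeas hXindep hXident hXmom hS hac 0 0
  have hr := hadamardRID_eq_erasureProcess hXmeas hXindep hXident hXmom hXlaw (fun _ => false) 0
  have hT : hadamardTransform X 0 0 = X 0 := by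
    ext ω; simp [hadamardTransform, hadamardMatrix, hadamardEntry, Matrix.mulVec, dotProduct]
  have hY : hadamardPast X 0 0 = fun _ _ => 0 := by
    ext ω j
    exact absurd j.2 (by simp)
  unfold hadamardRID condRID at hr
  change (limUnder atTop (condRIDRatio P (hadamardTransform X 0 0)
    (hadamardPast X 0 0))).toReal = δ at hr
  rw [hlim.limUnder_eq] at hr
  rw [← hr, ENNReal.ofReal_toReal (measure_ne_top _ _)]
  refine hlim.congr fun q => ?_
  unfold condRIDRatio ridRatio
  have hm : Measurable (fun ω => quantize q (X 0 ω)) := (measurable_quantize q).comp (hXmeas 0)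
  rw [hT, hY, discreteCondEntropy_of_indepFun hm measurable_const (indepFun_const_left _ _)]

end Source

/-! ### Random signs, the martingale property and polarization. -/

section Labels

variable {Ω' : Type*} [MeasurableSpace Ω'] {Q : Measure Ω'} {B : ℕ → Ω' → Bool}

lemma measurable_label (hB : ∀ k, Measurable (B k)) {k n : ℕ} (hk : k < n) :
    Measurable[labelFiltration B hB n] (B k) :=
  measurable_iff_comap_le.2 (le_iSup (fun k : Fin n => MeasurableSpace.comap (B k) inferInstance)
    ⟨k, hk⟩)

lemma measurable_erasureProcess (hB : ∀ k, Measurable (B k)) (α : ℝ) (n : ℕ) :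
    Measurable[labelFiltration B hB n] (fun ω' => erasureProcess α (fun k => B k ω') n) := by
  induction n with
  | zero => exact measurable_const
  | succ n ih =>
    have ih' := ih.mono ((labelFiltration B hB).mono n.le_succ) le_rfl
    refine Measurable.ite (measurable_label hB n.lt_succ_self (measurableSet_singleton true)) ?_ ?_
    · exact ih'.pow_const 2
    · exact (ih'.const_mul 2).sub (ih'.pow_const 2)

lemma measurable_pathIndex (hB : ∀ k, Measurable (B k)) (n : ℕ) :
    Measurable[labelFiltration B hB n] (fun ω' => pathIndex (fun k => B k ω') n) := by
  induction n with
  | zero => exact measurable_const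
  | succ n ih =>
    have ih' := ih.mono ((labelFiltration B hB).mono n.le_succ) le_rfl
    have hf : Measurable (fun z : Fin (2 ^ n) × Bool =>
        (⟨2 * (z.1 : ℕ) + z.2.toNat, by
          have h := z.1.isLt
          have h' := Bool.toNat_le z.2
          rw [pow_succ]
          omega⟩ : Fin (2 ^ (n + 1)))) := measurable_of_countable _
    exact hf.comp (ih'.prodMk (measurable_label hB n.lt_succ_self))

lemma indep_comap_labelFiltration (hB : ∀ k, Measurable (B k)) (hind : iIndepFun B Q) (n : ℕ) :
    Indep (MeasurableSpace.comap (B n) inferInstance) (labelFiltration B hB n) Q := by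
  have h := indep_iSup_of_disjoint (fun k => (hB k).comap_le) hind.iIndep
    (S := {n}) (T := Set.Iio n) (by simp)
  refine indep_of_indep_of_le_left (indep_of_indep_of_le_right h ?_) ?_
  · exact iSup_le fun k => le_iSup₂_of_le (k : ℕ) k.isLt le_rfl
  · exact le_iSup₂_of_le n rfl le_rfl

variable [IsProbabilityMeasure Q]

lemma measure_pathIndex_eq (hB : ∀ k, Measurable (B k)) (hind : iIndepFun B Q)
    (hunif : ∀ k, Q {ω' | B k ω' = true} = 1 / 2) (n : ℕ) (i : Fin (2 ^ n)) :
    Q.real {ω' | pathIndex (fun k => B k ω') n = i} = (1 / 2) ^ n := by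
  induction n with
  | zero =>
    have : {ω' | pathIndex (fun k => B k ω') 0 = i} = Set.univ :=
      Set.eq_univ_of_forall fun ω' => Subsingleton.elim (α := Fin 1) _ _
    simp [this]
  | succ n ih =>
    have hlt : (i : ℕ) / 2 < 2 ^ n := by
      have := i.isLt.trans_eq (pow_succ 2 n)
      omega
    set c : Bool := decide ((i : ℕ) % 2 = 1)
    have hset : {ω' | pathIndex (fun k => B k ω') (n + 1) = i} =
        B n ⁻¹' {c} ∩ {ω' | pathIndex (fun k => B k ω') n = ⟨(i : ℕ) / 2, hlt⟩} := by
      ext ω'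
      simp only [pathIndex, Fin.ext_iff, Set.mem_ofPred_eq, Set.mem_inter_iff, Set.mem_preimage,
        Set.mem_singleton_iff, c]
      cases B n ω' <;> simp <;> omega
    have hind' := (Indep_iff _ _ Q).1 (indep_comap_labelFiltration hB hind n)
      (B n ⁻¹' {c}) {ω' | pathIndex (fun k => B k ω') n = ⟨(i : ℕ) / 2, hlt⟩}
      ⟨{c}, measurableSet_singleton c, rfl⟩
      (measurable_pathIndex hB n (measurableSet_singleton _))
    have hc : Q.real (B n ⁻¹' {c}) = 1 / 2 := by
      have ht : Q.real (B n ⁻¹' {true}) = 1 / 2 := by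
        have : Q (B n ⁻¹' {true}) = 1 / 2 := hunif n
        simp [Measure.real, this]
      cases c with
      | true => exact ht
      | false =>
        have : B n ⁻¹' {false} = (B n ⁻¹' {true})ᶜ := by ext; simp
        rw [this, measureReal_compl (hB n (measurableSet_singleton _)), ht]
        simp
        norm_num
    rw [hset, Measure.real, hind', ENNReal.toReal_mul]
    change Q.real _ * Q.real _ = _
    rw [hc, ih, pow_succ, mul_comm]

/-- The random index is uniform, so fractions of indices are probabilities for the random path. -/
lemma measureReal_pathIndex_mem (hB : ∀ k, Measurable (B k)) (hind : iIndepFun B Q)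
    (hunif : ∀ k, Q {ω' | B k ω' = true} = 1 / 2) (n : ℕ) (A : Set (Fin (2 ^ n))) :
    Q.real {ω' | pathIndex (fun k => B k ω') n ∈ A} = (A.ncard : ℝ) / 2 ^ n := by
  classical
  have hset : {ω' | pathIndex (fun k => B k ω') n ∈ A} =
      ⋃ i ∈ A.toFinset, {ω' | pathIndex (fun k => B k ω') n = i} := by
    ext ω'; simp
  rw [hset, measureReal_biUnion_finset]
  · simp only [measure_pathIndex_eq hB hind hunif, Finset.sum_const, nsmul_eq_mul,
      Set.ncard_eq_toFinset_card']
    rw [one_div, inv_pow, div_eq_mul_inv]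
  · intro i _ j _ hij
    exact Set.disjoint_left.2 fun ω' (h : _ = i) (h' : _ = j) => hij (h.symm.trans h')
  · intro i _
    exact (labelFiltration B hB).le n _ (measurable_pathIndex hB n (measurableSet_singleton i))

lemma integrable_erasureProcess (hB : ∀ k, Measurable (B k)) {α : ℝ}
    (hα : α ∈ Set.Icc (0 : ℝ) 1) (n : ℕ) :
    Integrable (fun ω' => erasureProcess α (fun k => B k ω') n) Q := by
  refine Integrable.of_mem_Icc 0 1 ?_ (ae_of_all _ fun ω' => erasureProcess_mem_Icc hα _ n)
  exact ((measurable_erasureProcess hB α n).mono ((labelFiltration B hB).le n) le_rfl).aemeasurable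

lemma martingale_erasureProcess (hB : ∀ k, Measurable (B k)) (hind : iIndepFun B Q)
    (hunif : ∀ k, Q {ω' | B k ω' = true} = 1 / 2) {α : ℝ} (hα : α ∈ Set.Icc (0 : ℝ) 1) :
    Martingale (fun n ω' => erasureProcess α (fun k => B k ω') n) (labelFiltration B hB) Q := by
  refine martingale_nat (fun n => (measurable_erasureProcess hB α n).stronglyMeasurable)
    (integrable_erasureProcess hB hα) fun n => ?_
  set e : Ω' → ℝ := fun ω' => erasureProcess α (fun k => B k ω') n
  -- Both branches of the recursion read `e + (e - e²) σ`, with `σ` centred and independent of the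
  -- past signs.
  set σ : Ω' → ℝ := fun ω' => if B n ω' then -1 else 1 with hσ
  have hem := measurable_erasureProcess hB α n
  have hei : Integrable e Q := integrable_erasureProcess hB hα n
  have hσm : Measurable[MeasurableSpace.comap (B n) inferInstance] σ :=
    (measurable_of_countable (fun c : Bool => if c then (-1 : ℝ) else 1)).comp
      (comap_measurable (B n))
  have hσm' : Measurable σ := hσm.mono (hB n).comap_le le_rfl
  have hσi : Integrable σ Q := Integrable.of_mem_Icc (-1) 1 hσm'.aemeasurable
    (ae_of_all _ fun ω' => by simp only [hσ]; split_ifs <;> simp)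
  have hvm : Measurable[labelFiltration B hB n] (fun ω' => e ω' - e ω' ^ 2) :=
    hem.sub (hem.pow_const 2)
  have hvb : ∀ᵐ ω' ∂Q, ‖e ω' - e ω' ^ 2‖ ≤ 1 := ae_of_all _ fun ω' => by
    obtain ⟨h0, h1⟩ := erasureProcess_mem_Icc hα (fun k => B k ω') n
    change 0 ≤ e ω' at h0
    change e ω' ≤ 1 at h1
    rw [Real.norm_eq_abs, abs_le]
    constructor <;> nlinarith
  have hstep : (fun ω' => erasureProcess α (fun k => B k ω') (n + 1)) =
      e + (fun ω' => e ω' - e ω' ^ 2) * σ := by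
    ext ω'
    simp only [erasureProcess, Pi.add_apply, Pi.mul_apply, hσ, e]
    split_ifs <;> ring
  have hzero : ∫ ω', σ ω' ∂Q = 0 := by
    have hσ' : σ = fun ω' => 1 - 2 * Set.indicator {ω' | B n ω' = true} (1 : Ω' → ℝ) ω' := by
      ext ω'
      simp only [hσ, Set.indicator, Set.mem_ofPred_eq, Pi.one_apply]
      split_ifs <;> norm_num
    have hs : MeasurableSet {ω' | B n ω' = true} := hB n (measurableSet_singleton true)
    have hi : Integrable (fun ω' => 2 * Set.indicator {ω' | B n ω' = true} (1 : Ω' → ℝ) ω') Q :=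
      ((integrable_const (1 : ℝ)).indicator hs).const_mul 2
    rw [hσ']
    beta_reduce
    rw [integral_sub (integrable_const _) hi, integral_const_mul, integral_indicator_one hs]
    simp [Measure.real, hunif n]
  have hpull := condExp_stronglyMeasurable_mul_of_bound ((labelFiltration B hB).le n)
    hvm.stronglyMeasurable hσi 1 hvb
  have hcond := condExp_indep_eq (hB n).comap_le ((labelFiltration B hB).le n)
    hσm.stronglyMeasurable (indep_comap_labelFiltration hB hind n)
  have hadd : Q[e + (fun ω' => e ω' - e ω' ^ 2) * σ | labelFiltration B hB n] =ᵐ[Q]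
      Q[e | labelFiltration B hB n] +
        Q[(fun ω' => e ω' - e ω' ^ 2) * σ | labelFiltration B hB n] := condExp_add hei (hσi.bdd_mul
    (hvm.mono ((labelFiltration B hB).le n) le_rfl).aestronglyMeasurable hvb)
    (labelFiltration B hB n)
  rw [hstep]
  have he' : Q[e | labelFiltration B hB n] = e :=
    condExp_of_stronglyMeasurable ((labelFiltration B hB).le n) hem.stronglyMeasurable hei
  filter_upwards [hpull, hcond, hadd] with ω' h1 h2 h3
  rw [h3, Pi.add_apply, he', h1, Pi.mul_apply, h2, hzero, mul_zero, add_zero]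

/-- The erasure process with uniformly random signs polarizes. -/
lemma exists_limit_erasureProcess (hB : ∀ k, Measurable (B k)) (hind : iIndepFun B Q)
    (hunif : ∀ k, Q {ω' | B k ω' = true} = 1 / 2) {α : ℝ} (hα : α ∈ Set.Icc (0 : ℝ) 1) :
    ∃ Ilim : Ω' → ℝ, Measurable Ilim ∧
      (∀ᵐ ω' ∂Q, Tendsto (fun n => erasureProcess α (fun k => B k ω') n) atTop (𝓝 (Ilim ω'))) ∧
      (∀ᵐ ω' ∂Q, Ilim ω' = 0 ∨ Ilim ω' = 1) ∧ Q.real {ω' | Ilim ω' = 1} = α := by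
  have hmart := martingale_erasureProcess hB hind hunif hα
  have hbound : ∀ n, ∀ᵐ ω' ∂Q, ‖(erasureProcess α (fun k => B k ω') n)‖ ≤ 1 := fun n =>
    ae_of_all _ fun ω' => by
      obtain ⟨h0, h1⟩ := erasureProcess_mem_Icc hα (fun k => B k ω') n
      rw [Real.norm_eq_abs, abs_of_nonneg h0]
      exact h1
  have hex := hmart.submartingale.exists_ae_tendsto_of_bdd (R := 1) fun n =>
    (eLpNorm_le_of_ae_bound (hbound n)).trans (by simp)
  obtain ⟨I, hIm, hlim⟩ := measurable_limit_of_tendsto_metrizable_ae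
    (fun n => (integrable_erasureProcess hB hα n).aemeasurable) hex
  have h01 : ∀ᵐ ω' ∂Q, I ω' = 0 ∨ I ω' = 1 := by
    filter_upwards [hlim] with ω' h
    -- Increments of a convergent sequence tend to `0`. Squaring hides the sign, leaving `(e -
    -- e²)²`, so the limit is a root of `x = x²`.
    have h1 := (h.comp (tendsto_add_atTop_nat 1)).sub h
    have h2 : Tendsto (fun n => (erasureProcess α (fun k => B k ω') n -
        erasureProcess α (fun k => B k ω') n ^ 2) ^ 2) atTop (𝓝 ((I ω' - I ω') ^ 2)) := by
      refine (h1.pow 2).congr fun n => ?_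
      simp only [Function.comp, erasureProcess]
      split_ifs <;> ring
    have h3 := tendsto_nhds_unique h2 ((h.sub (h.pow 2)).pow 2)
    have h4 : I ω' * (I ω' - 1) = 0 := by
      have : (I ω' - I ω' ^ 2) ^ 2 = 0 := by rw [← h3]; ring
      have := pow_eq_zero_iff (two_ne_zero) |>.1 this
      linarith
    rcases mul_eq_zero.1 h4 with h | h
    · exact Or.inl h
    · exact Or.inr (by linarith)
  refine ⟨I, hIm, hlim, h01, ?_⟩
  -- The constant mean `α` passes to the limit, which is almost surely the indicator of `{I = 1}`.
  have hint := tendsto_integral_of_dominated_convergence (fun _ => (1 : ℝ))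
    (fun n => (integrable_erasureProcess hB hα n).aestronglyMeasurable) (integrable_const _)
    hbound hlim
  have hconst : ∀ n, ∫ ω', erasureProcess α (fun k => B k ω') n ∂Q = α := fun n => by
    have := hmart.setIntegral_eq (Nat.zero_le n) MeasurableSet.univ
    simp only [setIntegral_univ] at this
    rw [← this]
    simp [erasureProcess]
  simp only [hconst] at hint
  have hs : MeasurableSet {ω' | I ω' = 1} := hIm (measurableSet_singleton 1)
  rw [tendsto_nhds_unique tendsto_const_nhds hint, ← integral_indicator_one hs]
  refine integral_congr_ae ?_
  filter_upwards [h01] with ω' h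
  rcases h with h | h <;> simp [Set.indicator, h]

end Labels

/-! ### Fractions of polarized indices and the theorem. -/

/-- Polarization of the fractions of indices whose value is near `1` or near `0`. -/
lemma tendsto_fraction_of_erasureProcess {Ω' : Type*} [MeasurableSpace Ω'] {Q : Measure Ω'}
    [IsProbabilityMeasure Q] {B : ℕ → Ω' → Bool} (hB : ∀ k, Measurable (B k))
    (hind : iIndepFun B Q) (hunif : ∀ k, Q {ω' | B k ω' = true} = 1 / 2) {α : ℝ}
    (hα : α ∈ Set.Icc (0 : ℝ) 1) {I : (n : ℕ) → Fin (2 ^ n) → ℝ}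
    (hI : ∀ n b, I n (pathIndex b n) = erasureProcess α b n) {ε : ℝ}
    (hε : ε ∈ Set.Ioo (0 : ℝ) 1) :
    Tendsto (fun n => ({i : Fin (2 ^ n) | 1 - ε < I n i}.ncard : ℝ) / 2 ^ n) atTop (𝓝 α) ∧
      Tendsto (fun n => ({i : Fin (2 ^ n) | I n i < ε}.ncard : ℝ) / 2 ^ n) atTop (𝓝 (1 - α)) := by
  obtain ⟨J, hJm, hJ, hJ01, hJ1⟩ := exists_limit_erasureProcess hB hind hunif hα
  have hem : ∀ n, Measurable (fun ω' => erasureProcess α (fun k => B k ω') n) := fun n =>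
    (measurable_erasureProcess hB α n).mono ((labelFiltration B hB).le n) le_rfl
  have hJs : MeasurableSet {ω' | J ω' = 1} := hJm (measurableSet_singleton 1)
  constructor
  · have h := tendsto_measure_of_ae_tendsto_indicator_of_isFiniteMeasure (μ := Q) atTop hJs
      (As := fun n => {ω' | 1 - ε < erasureProcess α (fun k => B k ω') n})
      (fun n => measurableSet_lt measurable_const (hem n)) (by
        filter_upwards [hJ, hJ01] with ω' h h01
        rcases h01 with h0 | h1
        · rw [h0] at h
          filter_upwards [h.eventually_lt_const (show (0 : ℝ) < 1 - ε by linarith [hε.2])] with n hn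
          simp [h0, hn.le]
        · rw [h1] at h
          filter_upwards [h.eventually_const_lt (show 1 - ε < (1 : ℝ) by linarith [hε.1])] with n hn
          simp [h1, hn])
    have h' := (ENNReal.tendsto_toReal (measure_ne_top _ _)).comp h
    change Tendsto _ _ (𝓝 (Q.real _)) at h'
    rw [hJ1] at h'
    refine h'.congr fun n => ?_
    rw [← measureReal_pathIndex_mem hB hind hunif]
    simp only [Set.mem_ofPred_eq, hI]
    rfl
  · have hJ0 : Q.real {ω' | J ω' = 1}ᶜ = 1 - α := by
      rw [measureReal_compl hJs, hJ1, probReal_univ]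
    have h := tendsto_measure_of_ae_tendsto_indicator_of_isFiniteMeasure (μ := Q) atTop hJs.compl
      (As := fun n => {ω' | erasureProcess α (fun k => B k ω') n < ε})
      (fun n => measurableSet_lt (hem n) measurable_const) (by
        filter_upwards [hJ, hJ01] with ω' h h01
        rcases h01 with h0 | h1
        · rw [h0] at h
          filter_upwards [h.eventually_lt_const hε.1] with n hn
          simp [h0, hn]
        · rw [h1] at h
          filter_upwards [h.eventually_const_lt hε.2] with n hn
          simp [h1, hn.le])
    have h' := (ENNReal.tendsto_toReal (measure_ne_top _ _)).comp h
    change Tendsto _ _ (𝓝 (Q.real _)) at h'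
    rw [hJ0] at h'
    refine h'.congr fun n => ?_
    rw [← measureReal_pathIndex_mem hB hind hunif]
    simp only [Set.mem_ofPred_eq, hI]
    rfl

theorem mainTheorem3
    {Ω : Type*} [MeasurableSpace Ω] (P : Measure Ω) [IsProbabilityMeasure P]
    (X : ℕ → Ω → ℝ) (hXmeas : ∀ i, Measurable (X i)) (hXindep : iIndepFun X P)
    (hXident : ∀ i, IdentDistrib (X i) (X 0) P P)
    (δ : ℝ) (hXlaw : IsNonsingularMixture (P.map (X 0)) δ) (hXmom : MemLp (X 0) 2 P)
    {Ω' : Type*} [MeasurableSpace Ω'] (Q : Measure Ω') [IsProbabilityMeasure Q]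
    (B : ℕ → Ω' → Bool) (hBmeas : ∀ k, Measurable (B k)) (hBindep : iIndepFun B Q)
    (hBunif : ∀ k, Q {ω' | B k ω' = true} = 1 / 2) :
    -- the RIDs involved exist, and the RID of the source is the weight of its continuous part
    (RIDExists P (X 0) ∧ rid P (X 0) = δ) ∧
    (∀ (n : ℕ) (i : Fin (2 ^ n)),
      CondRIDExists P (hadamardTransform X n i) (hadamardPast X n i)) ∧
    -- they are exactly the erasure process with initial value `d(X)`
    (∀ (n : ℕ) (b : ℕ → Bool),
      hadamardRID P X n (pathIndex b n) = erasureProcess (rid P (X 0)) b n) ∧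
    -- with uniformly random signs they form a martingale polarizing to `{0, 1}`
    Martingale (fun n ω' => hadamardRID P X n (pathIndex (fun k => B k ω') n))
      (labelFiltration B hBmeas) Q ∧
    (∃ Ilim : Ω' → ℝ, Measurable Ilim ∧
      (∀ᵐ ω' ∂Q, Tendsto (fun n => hadamardRID P X n (pathIndex (fun k => B k ω') n)) atTop
        (𝓝 (Ilim ω'))) ∧
      (∀ᵐ ω' ∂Q, Ilim ω' = 0 ∨ Ilim ω' = 1) ∧
      Q.real {ω' | Ilim ω' = 1} = rid P (X 0)) ∧
    -- the fractions of indices with conditional RID near `1` and near `0`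
    (∀ ε ∈ Set.Ioo (0 : ℝ) 1,
      Tendsto (fun n => ({i : Fin (2 ^ n) | 1 - ε < hadamardRID P X n i}.ncard : ℝ) / 2 ^ n)
        atTop (𝓝 (rid P (X 0))) ∧
      Tendsto (fun n => ({i : Fin (2 ^ n) | hadamardRID P X n i < ε}.ncard : ℝ) / 2 ^ n)
        atTop (𝓝 (1 - rid P (X 0)))) := by
  have hδ : δ ∈ Set.Icc (0 : ℝ) 1 := hXlaw.1
  have hrid := tendsto_ridRatio hXmeas hXindep hXident hXmom hXlaw
  have hd : rid P (X 0) = δ := by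
    unfold rid
    rw [hrid.limUnder_eq, ENNReal.toReal_ofReal hδ.1]
  have hI := hadamardRID_eq_erasureProcess hXmeas hXindep hXident hXmom hXlaw
  rw [hd]
  simp only [hI]
  refine ⟨⟨⟨δ.toNNReal, hrid⟩, trivial⟩, fun n i => ?_, fun _ _ => trivial,
    martingale_erasureProcess hBmeas hBindep hBunif hδ,
    exists_limit_erasureProcess hBmeas hBindep hBunif hδ, fun ε hε =>
    tendsto_fraction_of_erasureProcess hBmeas hBindep hBunif hδ (fun n b => hI b n) hε⟩
  -- Existence is needed at every index `i`, so it comes directly from the limit rather than through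
  -- a sign path.
  obtain ⟨S, hS, hac, -⟩ := hXlaw.exists_countable
  have hlim := tendsto_condRIDRatio_hadamard hXmeas hXindep hXident hXmom hS hac n i
  exact ⟨(P {ω | HadamardInnovates n i (fun j => X j ω ∉ S)}).toNNReal, by
    rwa [ENNReal.coe_toNNReal (measure_ne_top _ _)]⟩
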